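/- Let $1\le\alpha\le 2$ and let $M_0\subset\mathbb{R}^3$ be a compact, smooth, strictly convex embedded surface. (Strictly convex means that the second fundamental form with respect to the outer unit normal is positive definite at every point.) There is a constant $C_1=C_1(M_0,\alpha)>0$, depending only on $M_0$ and $\alpha$, with the following property. Let $0<T<\infty$ and let $X:S^2\times[0,T)\to\mathbb{R}^3$ be any smooth family of embeddings with $X(S^2,0)=M_0$ that solves $$\frac{\partial X}{\partial t}=-K^{\alpha/2}\,\nu ,$$ where $K$ is the Gauss curvature and $\nu$ the outer unit normal of $M_t=X(S^2,t)$. Then for every $t\in[0,T)$ the surface $M_t$ is strictly convex, and at each of its points its principal radii of curvature $r_1,r_2$ (the reciprocals of the principal curvatures, in either order) satisfy $$0<\frac1{C_1}\le\frac{r_2}{r_1}\le C_1 .$$ -/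

import Mathlib

open Set Filter Topology Function
open scoped Manifold ContDiff

noncomputable section

/-- Euclidean space `ℝ³`. -/
abbrev E3 : Type := EuclideanSpace ℝ (Fin 3)

/-- The parameter plane `ℝ²` of the charts. -/
abbrev E2 : Type := EuclideanSpace ℝ (Fin 2)

/-- The unit sphere `S²`, with Mathlib's smooth structure. -/
abbrev S2 : Type := Metric.sphere (0 : E3) 1

instance factFinrankE3 : Fact (Module.finrank ℝ E3 = 2 + 1) := ⟨by simp⟩

/-- Smooth embeddings of the sphere in space: a smooth immersion that is a homeomorphism onto
its image. -/
structure IsSmoothEmbeddedSphere (X : S2 → E3) : Prop where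
  smooth : ContMDiff (𝓡 2) 𝓘(ℝ, E3) ∞ X
  immersion : ∀ p, Injective (mfderiv (𝓡 2) 𝓘(ℝ, E3) X p)
  embedding : IsEmbedding X

/-- The local parametrization of the surface `X` around `p`, through the chart of `S²` at `p`. -/
def localParam (X : S2 → E3) (p : S2) : E2 → E3 :=
  fun u => X ((chartAt E2 p).symm u)

/-- The coordinates of `p` in the chart of `S²` at `p`. -/
def coordAt (p : S2) : E2 := chartAt E2 p p

/-- The first fundamental form `g i j = ⟨∂ᵢφ, ∂ⱼφ⟩` at `p`, in the chart at `p`. -/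
def firstForm (X : S2 → E3) (p : S2) : Matrix (Fin 2) (Fin 2) ℝ :=
  Matrix.of fun i j => inner ℝ
    (fderiv ℝ (localParam X p) (coordAt p) (EuclideanSpace.single i 1))
    (fderiv ℝ (localParam X p) (coordAt p) (EuclideanSpace.single j 1))

/-- The second fundamental form `h i j = -⟨∂ᵢ∂ⱼφ, n⟩` at `p`, in the chart at `p`, with respect to
the unit normal `n`. The sign makes it positive on a round sphere with `n` pointing outwards. -/
def secondForm (X : S2 → E3) (p : S2) (n : E3) : Matrix (Fin 2) (Fin 2) ℝ :=
  Matrix.of fun i j => - inner ℝ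
    (fderiv ℝ (fderiv ℝ (localParam X p)) (coordAt p)
      (EuclideanSpace.single i 1) (EuclideanSpace.single j 1)) n

/-- The Gauss curvature `K = det h / det g` at `p`. -/
def gaussCurvature (X : S2 → E3) (p : S2) (n : E3) : ℝ :=
  (secondForm X p n).det / (firstForm X p).det

/-- `n` is the outer unit normal at `p` of the embedded closed surface `X`: it has length one, is
orthogonal to the tangent plane, and points into the unbounded component of the complement. -/
structure IsOuterUnitNormal (X : S2 → E3) (p : S2) (n : E3) : Prop where
  norm_eq_one : ‖n‖ = 1
  orthogonal : ∀ v : E2, inner ℝ (fderiv ℝ (localParam X p) (coordAt p) v) n = 0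
  outward : ∀ᶠ ε : ℝ in 𝓝[>] 0,
    ¬ Bornology.IsBounded (connectedComponentIn (range X)ᶜ (X p + ε • n))

/-- Strict convexity of a surface with outer unit normal `ν`: the second fundamental form is
positive definite at every point (equivalently, all principal curvatures are positive). -/
def IsStrictlyConvex (X ν : S2 → E3) : Prop :=
  ∀ p, (secondForm X p (ν p)).PosDef

/-- `r₁, r₂` are the principal radii of curvature at `p`: the eigenvalues, counted with
multiplicity and in either order, of the inverse `h⁻¹ g` of the Weingarten map `g⁻¹ h`. -/
def ArePrincipalRadii (X : S2 → E3) (p : S2) (n : E3) (r₁ r₂ : ℝ) : Prop :=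
  ((secondForm X p n)⁻¹ * firstForm X p).charpoly =
    (Polynomial.X - Polynomial.C r₁) * (Polynomial.X - Polynomial.C r₂)

/-- Where the second fundamental form is positive definite, the principal radii exist. -/
theorem exists_arePrincipalRadii (X : S2 → E3) (p : S2) (n : E3)
    (h : (secondForm X p n).PosDef) : ∃ r₁ r₂ : ℝ, ArePrincipalRadii X p n r₁ r₂ := by
  unfold ArePrincipalRadii
  have hg : firstForm X p 1 0 = firstForm X p 0 1 := by
    simp only [firstForm, Matrix.of_apply]; exact real_inner_comm _ _
  have hh : secondForm X p n 1 0 = secondForm X p n 0 1 := by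
    simpa using h.isHermitian.apply 0 1
  have hD := h.det_pos
  have ha : 0 < secondForm X p n 0 0 := h.diag_pos
  have hc : 0 < secondForm X p n 1 1 := h.diag_pos
  set H := secondForm X p n
  set G := firstForm X p
  set A := H⁻¹ * G with hA
  have hdisc : 0 ≤ A.trace ^ 2 - 4 * A.det := by
    have hD' := hD
    rw [Matrix.det_fin_two, hh] at hD'
    have key : 0 ≤ (H 1 1 * G 0 0 - H 0 0 * G 1 1) ^ 2 + 4 * (H 1 1 * G 0 1 - H 0 1 * G 1 1)
        * (H 0 0 * G 0 1 - H 0 1 * G 0 0) := by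
      have hac := mul_pos ha hc
      refine (mul_nonneg_iff_of_pos_left hac).1 ?_
      have e : H 0 0 * H 1 1 * ((H 1 1 * G 0 0 - H 0 0 * G 1 1) ^ 2
          + 4 * (H 1 1 * G 0 1 - H 0 1 * G 1 1) * (H 0 0 * G 0 1 - H 0 1 * G 0 0))
          = (2 * (H 0 0 * H 1 1) * G 0 1 - H 0 1 * (H 0 0 * G 1 1 + H 1 1 * G 0 0)) ^ 2
          + (H 0 0 * H 1 1 - H 0 1 * H 0 1) * (H 1 1 * G 0 0 - H 0 0 * G 1 1) ^ 2 := by ring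
      rw [e]
      exact add_nonneg (sq_nonneg _) (mul_nonneg hD'.le (sq_nonneg _))
    have e : A.trace ^ 2 - 4 * A.det = (H.det⁻¹) ^ 2 *
        ((H 1 1 * G 0 0 - H 0 0 * G 1 1) ^ 2 + 4 * (H 1 1 * G 0 1 - H 0 1 * G 1 1)
        * (H 0 0 * G 0 1 - H 0 1 * G 0 0)) := by
      simp only [hA, Matrix.inv_def, Matrix.trace_fin_two, Matrix.det_fin_two (H.det⁻¹ • !![H 1 1, -H 0 1; -H 0 1, H 0 0] * G),
        Matrix.adjugate_fin_two, Matrix.mul_apply, Fin.sum_univ_two, Matrix.smul_apply,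
        Ring.inverse_eq_inv', smul_eq_mul, Matrix.of_apply, Matrix.cons_val_zero,
        Matrix.cons_val_one, Matrix.cons_val', Matrix.cons_val_fin_one, hg, hh]
      ring
    rw [e]
    exact mul_nonneg (sq_nonneg _) key
  have hs := Real.sq_sqrt hdisc
  refine ⟨(A.trace - √(A.trace ^ 2 - 4 * A.det)) / 2,
    (A.trace + √(A.trace ^ 2 - 4 * A.det)) / 2, ?_⟩
  set r := √(A.trace ^ 2 - 4 * A.det)
  have e1 : A.trace = (A.trace - r) / 2 + (A.trace + r) / 2 := by ring
  have e2 : A.det = (A.trace - r) / 2 * ((A.trace + r) / 2) := by nlinarith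
  rw [Matrix.charpoly_fin_two, e2]
  conv_lhs => rw [e1]
  simp only [map_add, map_mul]
  ring_nf

/-- A smooth family `X t`, `0 ≤ t < T`, of embeddings of the sphere with outer unit normals `ν t`
that solves `∂X/∂t = -K^(α/2) ν`. -/
structure IsGaussCurvatureFlow (α T : ℝ) (X ν : ℝ → S2 → E3) : Prop where
  smooth : ContMDiffOn (𝓘(ℝ, ℝ).prod (𝓡 2)) 𝓘(ℝ, E3) ∞ (uncurry X) (Ico 0 T ×ˢ univ)
  embedding : ∀ t ∈ Ico 0 T, IsSmoothEmbeddedSphere (X t)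
  normal : ∀ t ∈ Ico 0 T, ∀ p, IsOuterUnitNormal (X t) p (ν t p)
  evolution : ∀ t ∈ Ico 0 T, ∀ p,
    HasDerivWithinAt (fun s => X s p)
      (-(gaussCurvature (X t) p (ν t p) ^ (α / 2)) • ν t p) (Ico 0 T) t

end

/-!
The estimate rests on two applications of the maximum principle to a surface moving with normal
velocity `-K ^ β ν`, `β = α / 2`. Both are pointwise computations in a graphical gauge: near a point
`(t₀, p₀)` with `t₀ > 0` the surface is written as a graph `u` over the plane spanned by two
principal directions (`exists_convexGraphFlow`), where the flow becomes
`∂ₜu = K ^ β √(1 + |∇u|²)`. At the base point `∇u = 0` and the Hessian of `u` is `diag(a, b)`, so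
that only second-order jets along the two coordinate lines and first-order jets in time are needed
(`HasJet`).

* At a spatial minimum of `K` one has `∂ₜK > 0`; hence `K` stays above its initial minimum `m`
  (`IsGaussCurvatureFlow.gauss_lower`). As long as `K > 0` the normal `ν = -K ^ (-β) ∂ₜX` is
  continuous in time, so the second fundamental form stays definite
  (`IsGaussCurvatureFlow.posDef`).
* For `G = K ^ (α - 2) (H² - 4K)`, the zero-order terms in the evolution equation cancel. At a
  spatial critical point of `G` the remaining gradient terms are multiples of a cubic form in the
  principal curvatures which is nonpositive because `0 ≤ 1 - β ≤ 1 / 2`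
  (`gradientTerm_nonpos`). Hence the maximum of `G` does not increase
  (`IsGaussCurvatureFlow.pinching_upper`).

Since `r₁ / r₂ + r₂ / r₁ = H² / K - 2 = 2 + G K ^ (1 - α)` and `α ≥ 1`, the ratio of the radii is
bounded by `2 + max G₀ · m ^ (1 - α)`. The functions `K` and `H²` do not depend on the choice of the
unit normal, and their values at a point of the surface depend only on the image of the embedding
(`curvature_eq_of_range_eq`); so this bound depends only on the initial surface and on `α`.
-/

/-! ### Directional jets of scalar functions -/

section Jets

variable {V : Type*} [NormedAddCommGroup V] [NormedSpace ℝ V]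

/-- The derivative of a scalar function in the fixed direction `v`, as a function of the base
point. -/
noncomputable def dirDeriv (v : V) (f : V → ℝ) : V → ℝ := fun z => fderiv ℝ f z v

theorem ContDiffAt.dirDeriv {f : V → ℝ} {z : V} (hf : ContDiffAt ℝ ∞ f z) (v : V) :
    ContDiffAt ℝ ∞ (dirDeriv v f) z :=
  (hf.fderiv_right (m := ∞) le_rfl).clm_apply contDiffAt_const

theorem Filter.EventuallyEq.dirDeriv {f g : V → ℝ} {z : V} (h : f =ᶠ[𝓝 z] g) (v : V) :
    dirDeriv v f =ᶠ[𝓝 z] dirDeriv v g := by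
  filter_upwards [h.fderiv (𝕜 := ℝ)] with y hy
  simp only [_root_.dirDeriv, hy]

theorem ContDiffAt.eventually_differentiableAt {f : V → ℝ} {z : V} (hf : ContDiffAt ℝ ∞ f z) :
    ∀ᶠ y in 𝓝 z, DifferentiableAt ℝ f y := by
  have h1 : ContDiffAt ℝ 1 f z := hf.of_le (by exact_mod_cast le_top)
  filter_upwards [h1.eventually (by simp)] with y hy
  exact hy.differentiableAt (by simp)

theorem dirDeriv_dirDeriv {f : V → ℝ} {z : V} (hf : ContDiffAt ℝ 2 f z) (v w : V) :
    dirDeriv v (dirDeriv w f) z = fderiv ℝ (fderiv ℝ f) z v w := by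
  have hd : DifferentiableAt ℝ (fderiv ℝ f) z :=
    (hf.fderiv_right (m := 1) (by norm_num)).differentiableAt (by simp)
  unfold dirDeriv
  rw [fderiv_clm_apply hd (differentiableAt_const w)]
  simp

theorem dirDeriv_comm {f : V → ℝ} {z : V} (hf : ContDiffAt ℝ ∞ f z) (v w : V) :
    dirDeriv v (dirDeriv w f) =ᶠ[𝓝 z] dirDeriv w (dirDeriv v f) := by
  have h2 : ContDiffAt ℝ 2 f z := hf.of_le (by norm_cast)
  filter_upwards [h2.eventually (by simp)] with y hy
  have hs : IsSymmSndFDerivAt ℝ f y := hy.isSymmSndFDerivAt (by simp)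
  rw [dirDeriv_dirDeriv hy, dirDeriv_dirDeriv hy]
  exact hs v w

/-- `f` is smooth at `z` and its restriction to the line `s ↦ z + s v` has the second-order
Taylor coefficients (without factorials) `f₀, f₁, f₂`. -/
structure HasJet (v z : V) (f : V → ℝ) (f₀ f₁ f₂ : ℝ) : Prop where
  smooth : ContDiffAt ℝ ∞ f z
  val : f z = f₀
  d1 : dirDeriv v f z = f₁
  d2 : dirDeriv v (dirDeriv v f) z = f₂

namespace HasJet

variable {v z : V} {f g : V → ℝ} {f₀ f₁ f₂ g₀ g₁ g₂ : ℝ}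

theorem of_contDiffAt (hf : ContDiffAt ℝ ∞ f z) (v : V) :
    HasJet v z f (f z) (dirDeriv v f z) (dirDeriv v (dirDeriv v f) z) :=
  ⟨hf, rfl, rfl, rfl⟩

theorem congr_values (h : HasJet v z f f₀ f₁ f₂) (h0 : f₀ = g₀) (h1 : f₁ = g₁) (h2 : f₂ = g₂) :
    HasJet v z f g₀ g₁ g₂ := by
  subst h0 h1 h2; exact h

theorem congr_fun (h : HasJet v z f f₀ f₁ f₂) (e : g =ᶠ[𝓝 z] f) : HasJet v z g f₀ f₁ f₂ :=
  ⟨h.smooth.congr_of_eventuallyEq e, e.eq_of_nhds.trans h.val,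
    (e.dirDeriv v).eq_of_nhds.trans h.d1, ((e.dirDeriv v).dirDeriv v).eq_of_nhds.trans h.d2⟩

theorem const (v z : V) (c : ℝ) : HasJet v z (fun _ => c) c 0 0 := by
  have h : dirDeriv v (fun _ : V => c) = fun _ => 0 := by
    funext y; simp [dirDeriv]
  refine ⟨contDiffAt_const, rfl, by rw [h], ?_⟩
  rw [h]; simp [dirDeriv]

theorem add (hf : HasJet v z f f₀ f₁ f₂) (hg : HasJet v z g g₀ g₁ g₂) :
    HasJet v z (fun y => f y + g y) (f₀ + g₀) (f₁ + g₁) (f₂ + g₂) := by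
  have key : ∀ {f g : V → ℝ}, ContDiffAt ℝ ∞ f z → ContDiffAt ℝ ∞ g z →
      dirDeriv v (fun y => f y + g y) =ᶠ[𝓝 z] fun y => dirDeriv v f y + dirDeriv v g y := by
    intro f g hf hg
    filter_upwards [hf.eventually_differentiableAt, hg.eventually_differentiableAt] with y h1 h2
    simp only [dirDeriv]
    rw [fderiv_fun_add h1 h2]
    simp
  refine ⟨hf.smooth.add hg.smooth, by rw [hf.val, hg.val], ?_, ?_⟩
  · rw [(key hf.smooth hg.smooth).eq_of_nhds, hf.d1, hg.d1]
  · rw [((key hf.smooth hg.smooth).dirDeriv v).eq_of_nhds,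
      (key (hf.smooth.dirDeriv v) (hg.smooth.dirDeriv v)).eq_of_nhds, hf.d2, hg.d2]

theorem mul (hf : HasJet v z f f₀ f₁ f₂) (hg : HasJet v z g g₀ g₁ g₂) :
    HasJet v z (fun y => f y * g y) (f₀ * g₀) (f₁ * g₀ + f₀ * g₁)
      (f₂ * g₀ + 2 * (f₁ * g₁) + f₀ * g₂) := by
  have key : ∀ {f g : V → ℝ}, ContDiffAt ℝ ∞ f z → ContDiffAt ℝ ∞ g z →
      dirDeriv v (fun y => f y * g y) =ᶠ[𝓝 z]
        fun y => dirDeriv v f y * g y + f y * dirDeriv v g y := by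
    intro f g hf hg
    filter_upwards [hf.eventually_differentiableAt, hg.eventually_differentiableAt] with y h1 h2
    simp only [dirDeriv]
    rw [fderiv_fun_mul h1 h2]
    simp only [add_apply, smul_apply, smul_eq_mul]
    ring
  have d1 := key hf.smooth hg.smooth
  refine ⟨hf.smooth.mul hg.smooth, by rw [hf.val, hg.val], ?_, ?_⟩
  · rw [d1.eq_of_nhds, hf.d1, hg.d1, hf.val, hg.val]
  · have hf' := of_contDiffAt (hf.smooth.dirDeriv v) v
    have hg' := of_contDiffAt (hg.smooth.dirDeriv v) v
    have e1 := key (hf.smooth.dirDeriv v) hg.smooth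
    have e2 := key hf.smooth (hg.smooth.dirDeriv v)
    have s1 := of_contDiffAt ((hf.smooth.dirDeriv v).mul hg.smooth) v
    have s2 := of_contDiffAt (hf.smooth.mul (hg.smooth.dirDeriv v)) v
    rw [(d1.dirDeriv v).eq_of_nhds, (s1.add s2).d1]
    change dirDeriv v (fun y => dirDeriv v f y * g y) z
      + dirDeriv v (fun y => f y * dirDeriv v g y) z = _
    rw [e1.eq_of_nhds, e2.eq_of_nhds, hf.d1, hf.d2, hg.d1, hg.d2, hf.val, hg.val]
    ring

theorem const_mul (c : ℝ) (hf : HasJet v z f f₀ f₁ f₂) :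
    HasJet v z (fun y => c * f y) (c * f₀) (c * f₁) (c * f₂) :=
  ((const v z c).mul hf).congr_values rfl (by ring) (by ring)

theorem sub (hf : HasJet v z f f₀ f₁ f₂) (hg : HasJet v z g g₀ g₁ g₂) :
    HasJet v z (fun y => f y - g y) (f₀ - g₀) (f₁ - g₁) (f₂ - g₂) :=
  ((hf.add (hg.const_mul (-1))).congr_values (by ring) (by ring) (by ring)).congr_fun
    (Eventually.of_forall fun y => by ring)

theorem sq (hf : HasJet v z f f₀ f₁ f₂) :
    HasJet v z (fun y => f y ^ 2) (f₀ ^ 2) (2 * f₀ * f₁) (2 * f₁ ^ 2 + 2 * f₀ * f₂) :=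
  ((hf.mul hf).congr_values (by ring) (by ring) (by ring)).congr_fun
    (Eventually.of_forall fun y => by ring)

theorem rpow (hf : HasJet v z f f₀ f₁ f₂) (h0 : 0 < f₀) (s : ℝ) :
    HasJet v z (fun y => f y ^ s) (f₀ ^ s) (s * f₀ ^ s * (f₁ / f₀))
      (s * f₀ ^ s * (f₂ / f₀) + s * (s - 1) * f₀ ^ s * (f₁ / f₀) ^ 2) := by
  have hz : f z ≠ 0 := by rw [hf.val]; exact h0.ne'
  have hpos : ∀ᶠ y in 𝓝 z, 0 < f y :=
    hf.smooth.continuousAt.eventually (lt_mem_nhds (by rw [hf.val]; exact h0))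
  have key : ∀ s : ℝ, dirDeriv v (fun y => f y ^ s) =ᶠ[𝓝 z]
      fun y => s * (f y ^ (s - 1) * dirDeriv v f y) := by
    intro s
    filter_upwards [hf.smooth.eventually_differentiableAt, hpos] with y h1 h2
    simp only [dirDeriv]
    rw [(h1.hasFDerivAt.rpow_const (Or.inl h2.ne')).fderiv]
    simp [mul_assoc]
  have hsm : ∀ s : ℝ, ContDiffAt ℝ ∞ (fun y => f y ^ s) z := fun s => hf.smooth.rpow_const_of_ne hz
  have e1 : f₀ ^ (s - 1) = f₀ ^ s / f₀ := Real.rpow_sub_one h0.ne' s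
  have e2 : f₀ ^ (s - 1 - 1) = f₀ ^ s / f₀ / f₀ := by rw [Real.rpow_sub_one h0.ne', e1]
  refine ⟨hsm s, by rw [hf.val], ?_, ?_⟩
  · rw [(key s).eq_of_nhds, hf.val, hf.d1, e1]; ring
  · have j1 : HasJet v z (fun y => f y ^ (s - 1)) (f₀ ^ (s - 1))
        ((s - 1) * (f₀ ^ (s - 1 - 1) * f₁)) _ :=
      ⟨hsm _, by rw [hf.val], by rw [(key (s - 1)).eq_of_nhds, hf.val, hf.d1], rfl⟩
    have j2 : HasJet v z (dirDeriv v f) f₁ f₂ _ := ⟨hf.smooth.dirDeriv v, hf.d1, hf.d2, rfl⟩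
    rw [((key s).dirDeriv v).eq_of_nhds, ((j1.mul j2).const_mul s).d1, e1, e2]
    ring

end HasJet

/-- At a local minimum along the line in direction `v`, the first derivative vanishes and the
second derivative is nonnegative. -/
theorem HasJet.of_isLocalMin {v z : V} {f : V → ℝ} {f₀ f₁ f₂ : ℝ} (hf : HasJet v z f f₀ f₁ f₂)
    (h : IsLocalMin (fun s : ℝ => f (z + s • v)) 0) : f₁ = 0 ∧ 0 ≤ f₂ := by
  have hline : ∀ s : ℝ, HasDerivAt (fun s : ℝ => z + s • v) v s := fun s => by
    simpa using ((hasDerivAt_id s).smul_const v).const_add z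
  have htend : Tendsto (fun s : ℝ => z + s • v) (𝓝 0) (𝓝 z) := by
    simpa using (hline 0).continuousAt.tendsto
  have key : ∀ {f : V → ℝ}, ContDiffAt ℝ ∞ f z →
      deriv (fun s : ℝ => f (z + s • v)) =ᶠ[𝓝 0] fun s => dirDeriv v f (z + s • v) := by
    intro f hf
    filter_upwards [htend.eventually hf.eventually_differentiableAt] with s hs
    exact (hs.hasFDerivAt.comp_hasDerivAt s (hline s)).deriv
  have d1 : deriv (fun s : ℝ => f (z + s • v)) 0 = f₁ := by
    rw [(key hf.smooth).eq_of_nhds]; simpa using hf.d1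
  have d2 : deriv (deriv (fun s : ℝ => f (z + s • v))) 0 = f₂ := by
    rw [(key hf.smooth).deriv_eq, (key (hf.smooth.dirDeriv v)).eq_of_nhds]
    simpa using hf.d2
  have h1 : f₁ = 0 := by rw [← d1]; exact h.deriv_eq_zero
  refine ⟨h1, ?_⟩
  by_contra hneg
  rw [not_le] at hneg
  have hcont : ContinuousAt (fun s : ℝ => f (z + s • v)) 0 := by
    refine ContinuousAt.comp (f := fun s : ℝ => z + s • v) ?_ (hline 0).continuousAt
    simpa using hf.smooth.continuousAt
  -- a negative second derivative makes the point a local maximum too, hence `f` locally constant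
  have hmax : IsLocalMax (fun s : ℝ => f (z + s • v)) 0 :=
    isLocalMax_of_deriv_deriv_neg (by rw [d2]; exact hneg) (by rw [d1, h1]) hcont
  have hconst : (fun s : ℝ => f (z + s • v)) =ᶠ[𝓝 0] fun _ => f (z + (0 : ℝ) • v) := by
    filter_upwards [h, hmax] with s h1 h2
    exact le_antisymm h2 h1
  have : deriv (deriv (fun s : ℝ => f (z + s • v))) 0 = 0 := by
    rw [(hconst.deriv).deriv_eq]; simp
  linarith

theorem HasJet.of_isLocalMax {v z : V} {f : V → ℝ} {f₀ f₁ f₂ : ℝ} (hf : HasJet v z f f₀ f₁ f₂)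
    (h : IsLocalMax (fun s : ℝ => f (z + s • v)) 0) : f₁ = 0 ∧ f₂ ≤ 0 := by
  have h' : IsLocalMin (fun s : ℝ => -1 * f (z + s • v)) 0 := by
    filter_upwards [h] with s hs
    linarith
  have := (hf.const_mul (-1)).of_isLocalMin h'
  exact ⟨by linarith, by linarith⟩

/-- A function whose values at earlier parameters on the line in direction `v` are at most its
value at the end point has nonnegative derivative there. -/
theorem HasJet.nonneg_of_eventually_le {v z : V} {f : V → ℝ} {f₀ f₁ f₂ : ℝ}
    (hf : HasJet v z f f₀ f₁ f₂) (h : ∀ᶠ s : ℝ in 𝓝[<] 0, f (z + s • v) ≤ f z) : 0 ≤ f₁ := by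
  have hline : HasDerivAt (fun s : ℝ => z + s • v) v 0 := by
    simpa using ((hasDerivAt_id (0 : ℝ)).smul_const v).const_add z
  have hd : HasDerivAt (fun s : ℝ => f (z + s • v)) f₁ 0 := by
    have h0 : HasFDerivAt f (fderiv ℝ f z) (z + (0 : ℝ) • v) := by
      simpa using (hf.smooth.differentiableAt (by simp)).hasFDerivAt
    have := h0.comp_hasDerivAt (0 : ℝ) hline
    rw [← hf.d1]; exact this
  have ht := hd.tendsto_slope.mono_left
    (nhdsWithin_mono (0 : ℝ) (fun s (hs : s ∈ Iio (0 : ℝ)) => (ne_of_lt hs : s ≠ 0)))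
  refine ge_of_tendsto ht ?_
  filter_upwards [h, self_mem_nhdsWithin] with s hs hs0
  rw [slope_def_field]
  have : s - 0 < 0 := by simpa using hs0
  refine div_nonneg_of_nonpos ?_ this.le
  simpa using hs

end Jets

/-! ### Curvature functions of graphs -/

section GraphCurvature

/-- The squared area element `1 + |∇u|²` of a graph with gradient `(p, q)`. -/
def graphArea (p q : ℝ) : ℝ := 1 + p ^ 2 + q ^ 2

/-- The Gauss curvature of a graph with gradient `(p, q)` and Hessian entries `r, s, t`. -/
noncomputable def graphGauss (p q r s t : ℝ) : ℝ :=
  (r * t - s ^ 2) * graphArea p q ^ (-2 : ℝ)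

/-- The squared mean curvature (`H = κ₁ + κ₂`) of a graph. -/
noncomputable def graphMeanSq (p q r s t : ℝ) : ℝ :=
  ((1 + q ^ 2) * r - 2 * (p * q * s) + (1 + p ^ 2) * t) ^ 2 * graphArea p q ^ (-3 : ℝ)

/-- The pinching quantity `K ^ γ (H² - 4K)` of a graph. -/
noncomputable def graphPinching (γ p q r s t : ℝ) : ℝ :=
  graphGauss p q r s t ^ γ * (graphMeanSq p q r s t - 4 * graphGauss p q r s t)

variable {V : Type*} [NormedAddCommGroup V] [NormedSpace ℝ V]
variable {v z : V} {ux uy uxx uxy uyy : V → ℝ} {x₁ x₂ y₁ y₂ a b A₁ A₂ B₁ B₂ c₁ c₂ : ℝ}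

theorem HasJet.graphArea (hx : HasJet v z ux 0 x₁ x₂) (hy : HasJet v z uy 0 y₁ y₂) :
    HasJet v z (fun ζ => graphArea (ux ζ) (uy ζ)) 1 0 (2 * (x₁ ^ 2 + y₁ ^ 2)) :=
  (((HasJet.const v z 1).add hx.sq).add hy.sq).congr_values (by ring) (by ring) (by ring)

theorem HasJet.graphArea_rpow (hx : HasJet v z ux 0 x₁ x₂) (hy : HasJet v z uy 0 y₁ y₂) (s : ℝ) :
    HasJet v z (fun ζ => _root_.graphArea (ux ζ) (uy ζ) ^ s) 1 0 (s * (2 * (x₁ ^ 2 + y₁ ^ 2))) :=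
  ((hx.graphArea hy).rpow one_pos s).congr_values (by simp) (by simp) (by simp)

theorem HasJet.graphGauss (hx : HasJet v z ux 0 x₁ x₂) (hy : HasJet v z uy 0 y₁ y₂)
    (hxx : HasJet v z uxx a A₁ A₂) (hxy : HasJet v z uxy 0 c₁ c₂) (hyy : HasJet v z uyy b B₁ B₂) :
    HasJet v z (fun ζ => graphGauss (ux ζ) (uy ζ) (uxx ζ) (uxy ζ) (uyy ζ)) (a * b)
      (A₁ * b + a * B₁)
      (A₂ * b + 2 * (A₁ * B₁) + a * B₂ - 2 * c₁ ^ 2 - 4 * (a * b) * (x₁ ^ 2 + y₁ ^ 2)) :=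
  (((hxx.mul hyy).sub hxy.sq).mul (hx.graphArea_rpow hy (-2))).congr_values (by ring) (by ring)
    (by ring)

theorem HasJet.graphMeanSq (hx : HasJet v z ux 0 x₁ x₂) (hy : HasJet v z uy 0 y₁ y₂)
    (hxx : HasJet v z uxx a A₁ A₂) (hxy : HasJet v z uxy 0 c₁ c₂) (hyy : HasJet v z uyy b B₁ B₂) :
    HasJet v z (fun ζ => graphMeanSq (ux ζ) (uy ζ) (uxx ζ) (uxy ζ) (uyy ζ)) ((a + b) ^ 2)
      (2 * (a + b) * (A₁ + B₁))
      (2 * (A₁ + B₁) ^ 2 + 2 * (a + b) * (A₂ + B₂ + 2 * y₁ ^ 2 * a + 2 * x₁ ^ 2 * b)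
        - 6 * (x₁ ^ 2 + y₁ ^ 2) * (a + b) ^ 2) :=
  (((((((HasJet.const v z 1).add hy.sq).mul hxx).sub (((hx.mul hy).mul hxy).const_mul 2)).add
    (((HasJet.const v z 1).add hx.sq).mul hyy)).sq).mul
    (hx.graphArea_rpow hy (-3))).congr_values (by ring) (by ring) (by ring)

theorem HasJet.graphPinching (hx : HasJet v z ux 0 x₁ x₂) (hy : HasJet v z uy 0 y₁ y₂)
    (hxx : HasJet v z uxx a A₁ A₂) (hxy : HasJet v z uxy 0 c₁ c₂) (hyy : HasJet v z uyy b B₁ B₂)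
    (hab : 0 < a * b) (γ : ℝ) {K₁ K₂ S₁ S₂ : ℝ} (hK₁ : K₁ = A₁ * b + a * B₁)
    (hK₂ : K₂ = A₂ * b + 2 * (A₁ * B₁) + a * B₂ - 2 * c₁ ^ 2 - 4 * (a * b) * (x₁ ^ 2 + y₁ ^ 2))
    (hS₁ : S₁ = 2 * (a + b) * (A₁ + B₁) - 4 * K₁)
    (hS₂ : S₂ = 2 * (A₁ + B₁) ^ 2 + 2 * (a + b) * (A₂ + B₂ + 2 * y₁ ^ 2 * a + 2 * x₁ ^ 2 * b)
        - 6 * (x₁ ^ 2 + y₁ ^ 2) * (a + b) ^ 2 - 4 * K₂) :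
    HasJet v z (fun ζ => graphPinching γ (ux ζ) (uy ζ) (uxx ζ) (uxy ζ) (uyy ζ))
      ((a * b) ^ γ * (a - b) ^ 2)
      ((a * b) ^ γ * (γ * (K₁ / (a * b)) * (a - b) ^ 2 + S₁))
      ((a * b) ^ γ * ((γ * (K₂ / (a * b)) + γ * (γ - 1) * (K₁ / (a * b)) ^ 2) * (a - b) ^ 2
        + 2 * γ * (K₁ / (a * b)) * S₁ + S₂)) := by
  have hK := hx.graphGauss hy hxx hxy hyy
  have hM := hx.graphMeanSq hy hxx hxy hyy
  subst hK₁ hK₂ hS₁ hS₂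
  exact ((hK.rpow hab γ).mul (hM.sub (hK.const_mul 4))).congr_values (by ring) (by ring) (by ring)

/-- The jet of the normal speed `K ^ β` multiplied by the factor `√(1 + |∇u|²)` that converts it
to the vertical speed of a graph. -/
theorem HasJet.graphSpeed (hx : HasJet v z ux 0 x₁ x₂) (hy : HasJet v z uy 0 y₁ y₂)
    (hxx : HasJet v z uxx a A₁ A₂) (hxy : HasJet v z uxy 0 c₁ c₂) (hyy : HasJet v z uyy b B₁ B₂)
    (hab : 0 < a * b) (β : ℝ) {K₁ K₂ : ℝ} (hK₁ : K₁ = A₁ * b + a * B₁)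
    (hK₂ : K₂ = A₂ * b + 2 * (A₁ * B₁) + a * B₂ - 2 * c₁ ^ 2 - 4 * (a * b) * (x₁ ^ 2 + y₁ ^ 2)) :
    HasJet v z (fun ζ => _root_.graphGauss (ux ζ) (uy ζ) (uxx ζ) (uxy ζ) (uyy ζ) ^ β *
        _root_.graphArea (ux ζ) (uy ζ) ^ (1 / 2 : ℝ))
      ((a * b) ^ β) (β * (a * b) ^ β * (K₁ / (a * b)))
      ((a * b) ^ β * (β * (K₂ / (a * b)) + β * (β - 1) * (K₁ / (a * b)) ^ 2
        + (x₁ ^ 2 + y₁ ^ 2))) := by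
  have hK := hx.graphGauss hy hxx hxy hyy
  subst hK₁ hK₂
  exact ((hK.rpow hab β).mul (hx.graphArea_rpow hy (1 / 2))).congr_values (by ring) (by ring)
    (by ring)

end GraphCurvature

section PointwiseEstimates

theorem gradientTerm_poly_nonpos {a b δ : ℝ} (ha : 0 < a) (hb : 0 < b) (h0 : 0 ≤ δ)
    (h1 : δ ≤ 1 / 2) :
    δ * (a - b) ^ 3 - 4 * a * (a - b) ^ 2 * δ * (2 - δ) + 4 * δ * a ^ 2 * (a - b)
      - 4 * a ^ 2 * b ≤ 0 := by
  -- the expression is convex in `δ`, with values `-4a²b` at `0` and `-(a + b)³ / 2` at `1/2`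
  have e : δ * (a - b) ^ 3 - 4 * a * (a - b) ^ 2 * δ * (2 - δ) + 4 * δ * a ^ 2 * (a - b)
      - 4 * a ^ 2 * b = -((1 - 2 * δ) * (4 * a ^ 2 * b) + δ * (a + b) ^ 3
        + 4 * a * (a - b) ^ 2 * (δ * (1 / 2 - δ))) := by ring
  have h2 : 0 ≤ 1 - 2 * δ := by linarith
  have h3 : 0 ≤ 1 / 2 - δ := by linarith
  rw [e]
  have : 0 ≤ (1 - 2 * δ) * (4 * a ^ 2 * b) + δ * (a + b) ^ 3
        + 4 * a * (a - b) ^ 2 * (δ * (1 / 2 - δ)) := by positivity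
  linarith

/-- The quadratic gradient terms in the evolution of the pinching quantity have a favourable sign
at a critical point. Here `p, r` are third derivatives of the graph, `k` is a component of the
gradient of `log K`, and the first hypothesis is criticality of the pinching quantity. -/
theorem gradientTerm_nonpos {a b δ p r k : ℝ} (ha : 0 < a) (hb : 0 < b) (h0 : 0 ≤ δ)
    (h1 : δ ≤ 1 / 2) (hc : p - r = δ * k * (a - b)) (hk : k * (a * b) = p * b + a * r) :
    (a - b) ^ 2 * (b * k ^ 2) * (6 * δ ^ 2 - 2 * δ)
      + 2 * (a + b) * (2 * (p * r) - 2 * r ^ 2 - δ * (a * b) * k ^ 2)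
      + 4 * δ * b * (a * b) * k ^ 2 - 2 * b * (p + r) ^ 2 ≤ 0 := by
  have hH : 0 < a + b := by linarith
  have hr : r = k * b * (a - δ * (a - b)) / (a + b) := by
    rw [eq_div_iff hH.ne']
    linear_combination (-b) * hc - hk
  have hp : p = r + δ * k * (a - b) := by linarith
  have key : (a - b) ^ 2 * (b * k ^ 2) * (6 * δ ^ 2 - 2 * δ)
      + 2 * (a + b) * (2 * (p * r) - 2 * r ^ 2 - δ * (a * b) * k ^ 2)
      + 4 * δ * b * (a * b) * k ^ 2 - 2 * b * (p + r) ^ 2 =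
      2 * b ^ 2 * k ^ 2 / (a + b) ^ 2 * (δ * (a - b) ^ 3 - 4 * a * (a - b) ^ 2 * δ * (2 - δ)
        + 4 * δ * a ^ 2 * (a - b) - 4 * a ^ 2 * b) := by
    rw [hp, hr]
    field_simp
    ring
  rw [key]
  exact mul_nonpos_of_nonneg_of_nonpos (by positivity) (gradientTerm_poly_nonpos ha hb h0 h1)

end PointwiseEstimates

/-! ### Pointwise estimates for the graphical flow -/

section GraphFlow

variable {V : Type*} [NormedAddCommGroup V] [NormedSpace ℝ V]

/-- The Gauss curvature of the graph of `u` over the plane with coordinate directions `ex, ey`. -/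
noncomputable def gaussOfGraph (ex ey : V) (u : V → ℝ) (ζ : V) : ℝ :=
  graphGauss (dirDeriv ex u ζ) (dirDeriv ey u ζ) (dirDeriv ex (dirDeriv ex u) ζ)
    (dirDeriv ex (dirDeriv ey u) ζ) (dirDeriv ey (dirDeriv ey u) ζ)

/-- The pinching quantity of the graph of `u` over the plane with coordinate directions
`ex, ey`. -/
noncomputable def pinchingOfGraph (γ : ℝ) (ex ey : V) (u : V → ℝ) (ζ : V) : ℝ :=
  graphPinching γ (dirDeriv ex u ζ) (dirDeriv ey u ζ) (dirDeriv ex (dirDeriv ex u) ζ)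
    (dirDeriv ex (dirDeriv ey u) ζ) (dirDeriv ey (dirDeriv ey u) ζ)

/-- A time-dependent graph `u`, moving with normal speed `K ^ β`, near a point at which its
gradient vanishes and its Hessian is diagonal with positive entries `a, b`. Space and time are
encoded by the directions `ex, ey, et`. -/
structure IsConvexGraphFlowAt (β : ℝ) (ex ey et z : V) (u : V → ℝ) (a b : ℝ) : Prop where
  smooth : ContDiffAt ℝ ∞ u z
  pos_a : 0 < a
  pos_b : 0 < b
  grad_x : dirDeriv ex u z = 0
  grad_y : dirDeriv ey u z = 0
  hess_xx : dirDeriv ex (dirDeriv ex u) z = a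
  hess_xy : dirDeriv ex (dirDeriv ey u) z = 0
  hess_yy : dirDeriv ey (dirDeriv ey u) z = b
  evolution : dirDeriv et u =ᶠ[𝓝 z] fun ζ => gaussOfGraph ex ey u ζ ^ β *
    graphArea (dirDeriv ex u ζ) (dirDeriv ey u ζ) ^ (1 / 2 : ℝ)

namespace IsConvexGraphFlowAt

variable {β : ℝ} {ex ey et z : V} {u : V → ℝ} {a b : ℝ}

/-- The jets in the two space directions and in time of the first and second derivatives of a
graph moving by `K ^ β`. The numbers `p, q, r, s` are the third derivatives, and `e₀, e₂, e₄` are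
the fourth derivatives entering the evolution of curvature functions. -/
theorem exists_jets (h : IsConvexGraphFlowAt β ex ey et z u a b) :
    ∃ p q r s e₀ e₂ e₄ : ℝ,
      (HasJet ex z (dirDeriv ex u) 0 a p ∧ HasJet ex z (dirDeriv ey u) 0 0 q ∧
        HasJet ex z (dirDeriv ex (dirDeriv ex u)) a p e₀ ∧
        (∃ c, HasJet ex z (dirDeriv ex (dirDeriv ey u)) 0 q c) ∧
        HasJet ex z (dirDeriv ey (dirDeriv ey u)) b r e₂) ∧
      (HasJet ey z (dirDeriv ex u) 0 0 r ∧ HasJet ey z (dirDeriv ey u) 0 b s ∧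
        HasJet ey z (dirDeriv ex (dirDeriv ex u)) a q e₂ ∧
        (∃ c, HasJet ey z (dirDeriv ex (dirDeriv ey u)) 0 r c) ∧
        HasJet ey z (dirDeriv ey (dirDeriv ey u)) b s e₄) ∧
      ∃ x₁ x₂ y₁ y₂ c₁ c₂ A B : ℝ,
        HasJet et z (dirDeriv ex u) 0 x₁ x₂ ∧ HasJet et z (dirDeriv ey u) 0 y₁ y₂ ∧
        HasJet et z (dirDeriv ex (dirDeriv ex u)) a
          (dirDeriv ex (dirDeriv ex (dirDeriv et u)) z) A ∧
        HasJet et z (dirDeriv ex (dirDeriv ey u)) 0 c₁ c₂ ∧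
        HasJet et z (dirDeriv ey (dirDeriv ey u)) b
          (dirDeriv ey (dirDeriv ey (dirDeriv et u)) z) B := by
  have hu := h.smooth
  have sx := hu.dirDeriv ex
  have sy := hu.dirDeriv ey
  have sxx := sx.dirDeriv ex
  have sxy := sy.dirDeriv ex
  have syy := sy.dirDeriv ey
  have cxy : dirDeriv ey (dirDeriv ex u) =ᶠ[𝓝 z] dirDeriv ex (dirDeriv ey u) :=
    dirDeriv_comm hu ey ex
  have cq : dirDeriv ey (dirDeriv ex (dirDeriv ex u)) =ᶠ[𝓝 z]
      dirDeriv ex (dirDeriv ex (dirDeriv ey u)) :=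
    (dirDeriv_comm sx ey ex).trans (cxy.dirDeriv ex)
  have cr : dirDeriv ey (dirDeriv ex (dirDeriv ey u)) =ᶠ[𝓝 z]
      dirDeriv ex (dirDeriv ey (dirDeriv ey u)) := dirDeriv_comm sy ey ex
  have ce : dirDeriv ey (dirDeriv ey (dirDeriv ex (dirDeriv ex u))) =ᶠ[𝓝 z]
      dirDeriv ex (dirDeriv ex (dirDeriv ey (dirDeriv ey u))) :=
    ((cq.dirDeriv ey).trans (dirDeriv_comm sxy ey ex)).trans (cr.dirDeriv ex)
  have ct : ∀ v, dirDeriv et (dirDeriv v (dirDeriv v u)) z =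
      dirDeriv v (dirDeriv v (dirDeriv et u)) z := fun v =>
    ((dirDeriv_comm (hu.dirDeriv v) et v).trans
      ((dirDeriv_comm hu et v).dirDeriv v)).eq_of_nhds
  have hyx : dirDeriv ey (dirDeriv ex u) z = 0 := by rw [cxy.eq_of_nhds, h.hess_xy]
  refine ⟨_, _, _, _, _, _, _,
    ⟨⟨sx, h.grad_x, h.hess_xx, rfl⟩, ⟨sy, h.grad_y, h.hess_xy, rfl⟩, ⟨sxx, h.hess_xx, rfl, rfl⟩,
      ⟨_, sxy, h.hess_xy, rfl, rfl⟩, ⟨syy, h.hess_yy, rfl, rfl⟩⟩,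
    ⟨⟨sx, h.grad_x, hyx, ?_⟩, ⟨sy, h.grad_y, h.hess_yy, rfl⟩,
      ⟨sxx, h.hess_xx, cq.eq_of_nhds, ce.eq_of_nhds⟩,
      ⟨_, sxy, h.hess_xy, cr.eq_of_nhds, rfl⟩, ⟨syy, h.hess_yy, rfl, rfl⟩⟩,
    _, _, _, _, _, _, _, _, ⟨sx, h.grad_x, rfl, rfl⟩, ⟨sy, h.grad_y, rfl, rfl⟩,
      ⟨sxx, h.hess_xx, ct ex, rfl⟩, ⟨sxy, h.hess_xy, rfl, rfl⟩, ⟨syy, h.hess_yy, ct ey, rfl⟩⟩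
  exact ((cxy.dirDeriv ey).trans cr).eq_of_nhds

/-- At a spatial minimum the Gauss curvature is strictly increasing in time. -/
theorem gauss_deriv_pos (h : IsConvexGraphFlowAt β ex ey et z u a b) (hβ : 0 < β)
    (hx : IsLocalMin (fun s : ℝ => gaussOfGraph ex ey u (z + s • ex)) 0)
    (hy : IsLocalMin (fun s : ℝ => gaussOfGraph ex ey u (z + s • ey)) 0) :
    ∃ k₁ k₂, HasJet et z (gaussOfGraph ex ey u) (a * b) k₁ k₂ ∧ 0 < k₁ := by
  obtain ⟨p, q, r, s, e₀, e₂, e₄, ⟨X1, X2, X3, ⟨_, X4⟩, X5⟩, ⟨Y1, Y2, Y3, ⟨_, Y4⟩, Y5⟩,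
    _, _, _, _, _, _, _, _, T1, T2, T3, T4, T5⟩ := h.exists_jets
  have ha := h.pos_a
  have hb := h.pos_b
  have hab : 0 < a * b := mul_pos ha hb
  obtain ⟨kx, kxx⟩ := (X1.graphGauss X2 X3 X4 X5).of_isLocalMin hx
  obtain ⟨ky, kyy⟩ := (Y1.graphGauss Y2 Y3 Y4 Y5).of_isLocalMin hy
  have kt := T1.graphGauss T2 T3 T4 T5
  refine ⟨_, _, kt, ?_⟩
  have fx := ((X1.graphSpeed X2 X3 X4 X5 hab β rfl rfl).congr_fun h.evolution).d2
  have fy := ((Y1.graphSpeed Y2 Y3 Y4 Y5 hab β rfl rfl).congr_fun h.evolution).d2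
  -- the second derivatives of `K` contribute with the right sign, and the reaction term
  -- `K ^ β a b (a + b)` is positive
  rw [fx, fy, kx, ky]
  have hF : 0 < (a * b) ^ β := Real.rpow_pos_of_pos hab β
  generalize (a * b) ^ β = F at *
  rw [zero_div]
  have t1 := div_nonneg kxx hab.le
  have t2 := div_nonneg kyy hab.le
  generalize (_ / (a * b) : ℝ) = Q at t1 ⊢
  generalize (_ / (a * b) : ℝ) = R at t2 ⊢
  have : 0 ≤ F * (β * Q) * b + a * (F * (β * R)) := by positivity
  have : 0 < F * a ^ 2 * b + a * (F * b ^ 2) := by positivity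
  linarith

/-- At a spatial maximum where the principal curvatures differ, the pinching quantity
`K ^ (2β - 2) (H² - 4K)` is nonincreasing in time. -/
theorem pinching_deriv_nonpos (h : IsConvexGraphFlowAt β ex ey et z u a b) (hβ : 1 / 2 ≤ β)
    (hβ1 : β ≤ 1) (hne : a ≠ b)
    (hx : IsLocalMax (fun s : ℝ => pinchingOfGraph (2 * β - 2) ex ey u (z + s • ex)) 0)
    (hy : IsLocalMax (fun s : ℝ => pinchingOfGraph (2 * β - 2) ex ey u (z + s • ey)) 0) :
    ∃ g₀ g₁ g₂, HasJet et z (pinchingOfGraph (2 * β - 2) ex ey u) g₀ g₁ g₂ ∧ g₁ ≤ 0 := by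
  obtain ⟨p, q, r, s, e₀, e₂, e₄, ⟨X1, X2, X3, ⟨_, X4⟩, X5⟩, ⟨Y1, Y2, Y3, ⟨_, Y4⟩, Y5⟩,
    _, _, _, _, _, _, _, _, T1, T2, T3, T4, T5⟩ := h.exists_jets
  have ha := h.pos_a
  have hb := h.pos_b
  have hab : 0 < a * b := mul_pos ha hb
  have hd : a - b ≠ 0 := sub_ne_zero.2 hne
  have gt := T1.graphPinching T2 T3 T4 T5 hab (2 * β - 2) rfl rfl rfl rfl
  refine ⟨_, _, _, gt, ?_⟩
  obtain ⟨Kx, hKx⟩ : ∃ Kx, Kx = p * b + a * r := ⟨_, rfl⟩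
  obtain ⟨Ky, hKy⟩ : ∃ Ky, Ky = q * b + a * s := ⟨_, rfl⟩
  obtain ⟨Kxx, hKxx⟩ : ∃ Kxx, Kxx = e₀ * b + 2 * (p * r) + a * e₂ - 2 * q ^ 2
    - 4 * (a * b) * (a ^ 2 + 0 ^ 2) := ⟨_, rfl⟩
  obtain ⟨Kyy, hKyy⟩ : ∃ Kyy, Kyy = e₂ * b + 2 * (q * s) + a * e₄ - 2 * r ^ 2
    - 4 * (a * b) * (0 ^ 2 + b ^ 2) := ⟨_, rfl⟩
  obtain ⟨gx, gxx⟩ :=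
    (X1.graphPinching X2 X3 X4 X5 hab (2 * β - 2) hKx hKxx rfl rfl).of_isLocalMax hx
  obtain ⟨gy, gyy⟩ :=
    (Y1.graphPinching Y2 Y3 Y4 Y5 hab (2 * β - 2) hKy hKyy rfl rfl).of_isLocalMax hy
  have fx := ((X1.graphSpeed X2 X3 X4 X5 hab β hKx hKxx).congr_fun h.evolution).d2
  have fy := ((Y1.graphSpeed Y2 Y3 Y4 Y5 hab β hKy hKyy).congr_fun h.evolution).d2
  rw [fx, fy]
  have hP : 0 < (a * b) ^ (2 * β - 2) := Real.rpow_pos_of_pos hab _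
  have hF : 0 < (a * b) ^ β := Real.rpow_pos_of_pos hab β
  generalize (a * b) ^ (2 * β - 2) = P at *
  generalize (a * b) ^ β = F at *
  obtain ⟨k, hk⟩ : ∃ k, k = Kx / (a * b) := ⟨_, rfl⟩
  obtain ⟨l, hl⟩ : ∃ l, l = Ky / (a * b) := ⟨_, rfl⟩
  obtain ⟨kk, hkk⟩ : ∃ k, k = Kxx / (a * b) := ⟨_, rfl⟩
  obtain ⟨ll, hll⟩ : ∃ l, l = Kyy / (a * b) := ⟨_, rfl⟩
  rw [← hk] at gx gxx ⊢
  rw [← hl] at gy gyy ⊢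
  rw [← hkk] at gxx ⊢
  rw [← hll] at gyy ⊢
  rw [eq_div_iff hab.ne'] at hk hl hkk hll
  obtain ⟨δ, hδ⟩ : ∃ δ, δ = 1 - β := ⟨_, rfl⟩
  obtain rfl : β = 1 - δ := by linarith
  have h0 : 0 ≤ δ := by linarith
  have h1 : δ ≤ 1 / 2 := by linarith
  have cx : p - r = δ * k * (a - b) := by
    have := (mul_eq_zero.1 gx).resolve_left hP.ne'
    refine mul_left_cancel₀ hd (mul_left_cancel₀ (two_ne_zero (α := ℝ)) ?_)
    linear_combination this + 4 * hKx
  have cy : s - q = δ * l * (b - a) := by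
    have := (mul_eq_zero.1 gy).resolve_left hP.ne'
    refine mul_left_cancel₀ hd (mul_left_cancel₀ (two_ne_zero (α := ℝ)) ?_)
    linear_combination -this - 4 * hKy
  have EX := gradientTerm_nonpos ha hb h0 h1 cx (hk.trans hKx)
  have EY := gradientTerm_nonpos (a := b) (b := a) (p := s) (r := q) (k := l) hb ha h0 h1 cy
    (by linarith)
  have RX := nonpos_of_mul_nonpos_right gxx hP
  have RY := nonpos_of_mul_nonpos_right gyy hP
  refine mul_nonpos_of_nonneg_of_nonpos hP.le ?_
  have hH : 0 < a + b := by linarith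
  have hr : r = k * b * (a - δ * (a - b)) / (a + b) := by
    rw [eq_div_iff hH.ne']
    linear_combination (-b) * cx - hk - hKx
  have hp : p = r + δ * k * (a - b) := by linarith
  have hq : q = l * a * (b - δ * (b - a)) / (a + b) := by
    rw [eq_div_iff hH.ne']
    linear_combination (-a) * cy - hl - hKy
  have hs : s = q + δ * l * (b - a) := by linarith
  have he₀ : e₀ = (Kxx - 2 * (p * r) - a * e₂ + 2 * q ^ 2 + 4 * a ^ 3 * b) / b := by
    rw [eq_div_iff hb.ne']
    linear_combination -hKxx
  have he₄ : e₄ = (Kyy - 2 * (q * s) - e₂ * b + 2 * r ^ 2 + 4 * a * b ^ 3) / a := by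
    rw [eq_div_iff ha.ne']
    linear_combination -hKyy
  have hF' : 0 ≤ (1 - δ) * F / (a * b) := div_nonneg (mul_nonneg (by linarith) hF.le) hab.le
  have hsum := mul_nonpos_of_nonneg_of_nonpos hF' (add_nonpos (add_nonpos
    (mul_nonpos_of_nonneg_of_nonpos hb.le RX) (mul_nonpos_of_nonneg_of_nonpos ha.le RY))
    (add_nonpos EX EY))
  -- the reaction terms cancel, so the time derivative is exactly this combination
  refine le_trans (le_of_eq ?_) hsum
  clear RX RY EX EY hsum hF' gx gxx gy gyy fx fy gt
  rw [he₀, he₄, ← hk, ← hl, ← hkk, ← hll, hs, hp, hq, hr]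
  field_simp
  ring

end IsConvexGraphFlowAt

end GraphFlow

/-! ### Parametrized surfaces and changes of parameters -/

section ParametrizedSurfaces

theorem fderiv_comp_param {E F G : Type*} [NormedAddCommGroup E] [NormedSpace ℝ E]
    [NormedAddCommGroup F] [NormedSpace ℝ F] [NormedAddCommGroup G] [NormedSpace ℝ G]
    {σ : E → F} {Ψ : F → G} {φ : E → G} {v : E} (hσ : ContDiffAt ℝ 2 σ v)
    (hΨ : ContDiffAt ℝ 2 Ψ (σ v)) (e : φ =ᶠ[𝓝 v] fun w => Ψ (σ w)) :
    (∀ x, fderiv ℝ φ v x = fderiv ℝ Ψ (σ v) (fderiv ℝ σ v x)) ∧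
    ∀ x y, fderiv ℝ (fderiv ℝ φ) v x y =
      fderiv ℝ (fderiv ℝ Ψ) (σ v) (fderiv ℝ σ v x) (fderiv ℝ σ v y) +
        fderiv ℝ Ψ (σ v) (fderiv ℝ (fderiv ℝ σ) v x y) := by
  have hev : fderiv ℝ φ =ᶠ[𝓝 v] fun w => (fderiv ℝ Ψ (σ w)).comp (fderiv ℝ σ w) := by
    refine e.fderiv.trans ?_
    have h1 := hσ.continuousAt.eventually (hΨ.eventually (by simp))
    filter_upwards [h1, hσ.eventually (by simp)] with w hw1 hw2
    exact fderiv_comp w (hw1.differentiableAt (by simp)) (hw2.differentiableAt (by simp))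
  refine ⟨fun x => by rw [hev.eq_of_nhds]; rfl, fun x y => ?_⟩
  have d1 : DifferentiableAt ℝ (fderiv ℝ Ψ) (σ v) :=
    (hΨ.fderiv_right (m := 1) (by norm_num)).differentiableAt (by simp)
  have d2 : DifferentiableAt ℝ (fderiv ℝ σ) v :=
    (hσ.fderiv_right (m := 1) (by norm_num)).differentiableAt (by simp)
  have d3 : DifferentiableAt ℝ σ v := hσ.differentiableAt (by simp)
  have d4 : HasFDerivAt (fun w => fderiv ℝ Ψ (σ w))
      ((fderiv ℝ (fderiv ℝ Ψ) (σ v)).comp (fderiv ℝ σ v)) v :=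
    d1.hasFDerivAt.comp v d3.hasFDerivAt
  rw [hev.fderiv_eq, (d4.clm_comp d2.hasFDerivAt).fderiv]
  simp [add_comm]

/-- The standard basis vectors of the parameter plane. -/
noncomputable abbrev stdE2 (i : Fin 2) : E2 := EuclideanSpace.single i 1

/-- The first fundamental form of a parametrized surface `Ψ`. -/
noncomputable def paramFirstForm (Ψ : E2 → E3) (v : E2) : Matrix (Fin 2) (Fin 2) ℝ :=
  Matrix.of fun i j => inner ℝ (fderiv ℝ Ψ v (stdE2 i)) (fderiv ℝ Ψ v (stdE2 j))

/-- The second fundamental form of a parametrized surface `Ψ` with respect to `n`. -/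
noncomputable def paramSecondForm (Ψ : E2 → E3) (v : E2) (n : E3) : Matrix (Fin 2) (Fin 2) ℝ :=
  Matrix.of fun i j => - inner ℝ (fderiv ℝ (fderiv ℝ Ψ) v (stdE2 i) (stdE2 j)) n

/-- The determinant of three vectors of `ℝ³`. -/
noncomputable def tripleProduct (x y w : E3) : ℝ :=
  x 0 * (y 1 * w 2 - y 2 * w 1) - x 1 * (y 0 * w 2 - y 2 * w 0) + x 2 * (y 0 * w 1 - y 1 * w 0)

/-- A unit vector `n` orthogonal to `x` and `y` is parallel to `x × y`, in coordinates: the last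
three equations say that `(x × y) × n = ⟨x, n⟩ y - ⟨y, n⟩ x` vanishes. -/
theorem cross_parallel_normal {x y n : E3} (hn : ‖n‖ = 1) (hx : inner ℝ x n = 0)
    (hy : inner ℝ y n = 0) :
    n 0 ^ 2 + n 1 ^ 2 + n 2 ^ 2 = 1 ∧
    (x 2 * y 0 - x 0 * y 2) * n 2 - (x 0 * y 1 - x 1 * y 0) * n 1 = 0 ∧
    (x 0 * y 1 - x 1 * y 0) * n 0 - (x 1 * y 2 - x 2 * y 1) * n 2 = 0 ∧
    (x 1 * y 2 - x 2 * y 1) * n 1 - (x 2 * y 0 - x 0 * y 2) * n 0 = 0 := by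
  have h1 : ‖n‖ ^ 2 = 1 := by rw [hn]; norm_num
  rw [EuclideanSpace.norm_sq_eq, Fin.sum_univ_three] at h1
  simp only [PiLp.inner_apply, Fin.sum_univ_three, RCLike.inner_apply, conj_trivial] at hx hy
  refine ⟨by simpa using h1, ?_, ?_, ?_⟩
  · linear_combination y 0 * hx - x 0 * hy
  · linear_combination y 1 * hx - x 1 * hy
  · linear_combination y 2 * hx - x 2 * hy

theorem tripleProduct_eq_mul_inner {x y n : E3} (hn : ‖n‖ = 1) (hx : inner ℝ x n = 0)
    (hy : inner ℝ y n = 0) (w : E3) :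
    tripleProduct x y w = tripleProduct x y n * inner ℝ w n := by
  obtain ⟨h1, c0, c1, c2⟩ := cross_parallel_normal hn hx hy
  simp only [PiLp.inner_apply, Fin.sum_univ_three, RCLike.inner_apply, conj_trivial]
  simp only [tripleProduct]
  linear_combination (-(x 0 * (y 1 * w 2 - y 2 * w 1) - x 1 * (y 0 * w 2 - y 2 * w 0) +
      x 2 * (y 0 * w 1 - y 1 * w 0))) * h1 +
    w 0 * (n 1 * c2 - n 2 * c1) + w 1 * (n 2 * c0 - n 0 * c2) + w 2 * (n 0 * c1 - n 1 * c0)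

theorem tripleProduct_sq {x y n : E3} (hn : ‖n‖ = 1) (hx : inner ℝ x n = 0)
    (hy : inner ℝ y n = 0) :
    tripleProduct x y n ^ 2 = inner ℝ x x * inner ℝ y y - inner ℝ x y * inner ℝ y x := by
  obtain ⟨h1, c0, c1, c2⟩ := cross_parallel_normal hn hx hy
  simp only [PiLp.inner_apply, Fin.sum_univ_three, RCLike.inner_apply, conj_trivial]
  simp only [tripleProduct]
  linear_combination ((x 1 * y 2 - x 2 * y 1) ^ 2 + (x 2 * y 0 - x 0 * y 2) ^ 2 +
      (x 0 * y 1 - x 1 * y 0) ^ 2) * h1 -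
    ((x 2 * y 0 - x 0 * y 2) * n 2 - (x 0 * y 1 - x 1 * y 0) * n 1) * c0 -
    ((x 0 * y 1 - x 1 * y 0) * n 0 - (x 1 * y 2 - x 2 * y 1) * n 2) * c1 -
    ((x 1 * y 2 - x 2 * y 1) * n 1 - (x 2 * y 0 - x 0 * y 2) * n 0) * c2

/-- The Gauss curvature of a parametrized surface, written without choosing a unit normal: the
triple products `[∂₀Ψ, ∂₁Ψ, ∂ᵢ∂ⱼΨ]` are the entries of the second fundamental form, up to a common
sign and the factor `√(det g)`. -/
noncomputable def paramGauss (Ψ : E2 → E3) (v : E2) : ℝ :=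
  let d : Fin 2 → Fin 2 → ℝ := fun i j => tripleProduct (fderiv ℝ Ψ v (stdE2 0))
    (fderiv ℝ Ψ v (stdE2 1)) (fderiv ℝ (fderiv ℝ Ψ) v (stdE2 i) (stdE2 j))
  (d 0 0 * d 1 1 - d 0 1 * d 1 0) / (paramFirstForm Ψ v).det ^ 2

/-- The square of the mean curvature (the sum of the principal curvatures) of a parametrized
surface, written without choosing a unit normal. -/
noncomputable def paramMeanSq (Ψ : E2 → E3) (v : E2) : ℝ :=
  let d : Fin 2 → Fin 2 → ℝ := fun i j => tripleProduct (fderiv ℝ Ψ v (stdE2 0))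
    (fderiv ℝ Ψ v (stdE2 1)) (fderiv ℝ (fderiv ℝ Ψ) v (stdE2 i) (stdE2 j))
  let g := paramFirstForm Ψ v
  (g 1 1 * d 0 0 - g 0 1 * d 1 0 - g 1 0 * d 0 1 + g 0 0 * d 1 1) ^ 2 / g.det ^ 3

theorem paramFirstForm_det_pos {Ψ : E2 → E3} {v : E2} (h : Injective (fderiv ℝ Ψ v)) :
    0 < (paramFirstForm Ψ v).det := by
  rw [Matrix.det_fin_two]
  simp only [paramFirstForm, Matrix.of_apply]
  set A := fderiv ℝ Ψ v
  set x := A (stdE2 0) with hx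
  set y := A (stdE2 1) with hy
  have hy0 : y ≠ 0 := by
    intro h0
    have : stdE2 1 = 0 := h (by rw [← hy, h0, map_zero])
    have := congrArg (fun w : E2 => w 1) this
    simp at this
  have hyy : 0 < inner ℝ y y := real_inner_self_pos.2 hy0
  have hne : inner ℝ y y • x - inner ℝ x y • y ≠ 0 := by
    intro h0
    have h1 : A ((inner ℝ y y : ℝ) • stdE2 0 - (inner ℝ x y : ℝ) • stdE2 1) = A 0 := by
      rw [map_sub, map_smul, map_smul, ← hx, ← hy, h0, map_zero]
    have := congrArg (fun w : E2 => w 0) (h h1)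
    simp at this
    exact hy0 this
  have hpos := real_inner_self_pos.2 hne
  rw [inner_sub_left, inner_sub_right, inner_sub_right] at hpos
  simp only [real_inner_smul_left, real_inner_smul_right] at hpos
  rw [real_inner_comm x y] at *
  refine (mul_pos_iff_of_pos_left hyy).1 ?_
  nlinarith

variable {Ψ φ : E2 → E3} {v : E2} {n : E3}

theorem paramSecondForm_tripleProduct (hn : ‖n‖ = 1)
    (horth : ∀ w, inner ℝ (fderiv ℝ Ψ v w) n = 0) (i j : Fin 2) :
    tripleProduct (fderiv ℝ Ψ v (stdE2 0)) (fderiv ℝ Ψ v (stdE2 1))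
      (fderiv ℝ (fderiv ℝ Ψ) v (stdE2 i) (stdE2 j)) =
    -(tripleProduct (fderiv ℝ Ψ v (stdE2 0)) (fderiv ℝ Ψ v (stdE2 1)) n *
      paramSecondForm Ψ v n i j) := by
  rw [tripleProduct_eq_mul_inner hn (horth _) (horth _)]
  simp [paramSecondForm]

theorem paramGauss_eq (hinj : Injective (fderiv ℝ Ψ v)) (hn : ‖n‖ = 1)
    (horth : ∀ w, inner ℝ (fderiv ℝ Ψ v w) n = 0) :
    paramGauss Ψ v = (paramSecondForm Ψ v n).det / (paramFirstForm Ψ v).det := by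
  have hg := paramFirstForm_det_pos hinj
  have hsq := tripleProduct_sq hn (horth (stdE2 0)) (horth (stdE2 1))
  have hsq' : tripleProduct (fderiv ℝ Ψ v (stdE2 0)) (fderiv ℝ Ψ v (stdE2 1)) n ^ 2 =
      (paramFirstForm Ψ v).det := by
    rw [hsq, Matrix.det_fin_two]; rfl
  simp only [paramGauss, paramSecondForm_tripleProduct hn horth]
  rw [Matrix.det_fin_two (paramSecondForm Ψ v n), div_eq_div_iff (by positivity) hg.ne', ← hsq']
  ring

theorem trace_inv_mul_fin_two (A B : Matrix (Fin 2) (Fin 2) ℝ) :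
    (A⁻¹ * B).trace =
      (A 1 1 * B 0 0 - A 0 1 * B 1 0 - A 1 0 * B 0 1 + A 0 0 * B 1 1) / A.det := by
  simp only [Matrix.inv_def, Matrix.trace_fin_two, Matrix.adjugate_fin_two, Matrix.mul_apply,
    Fin.sum_univ_two, Matrix.smul_apply, Ring.inverse_eq_inv', smul_eq_mul, Matrix.of_apply,
    Matrix.cons_val_zero, Matrix.cons_val_one, Matrix.cons_val', Matrix.cons_val_fin_one]
  ring

theorem paramMeanSq_eq (hinj : Injective (fderiv ℝ Ψ v)) (hn : ‖n‖ = 1)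
    (horth : ∀ w, inner ℝ (fderiv ℝ Ψ v w) n = 0) :
    paramMeanSq Ψ v = ((paramFirstForm Ψ v)⁻¹ * paramSecondForm Ψ v n).trace ^ 2 := by
  have hg := paramFirstForm_det_pos hinj
  have hsq := tripleProduct_sq hn (horth (stdE2 0)) (horth (stdE2 1))
  have hsq' : tripleProduct (fderiv ℝ Ψ v (stdE2 0)) (fderiv ℝ Ψ v (stdE2 1)) n ^ 2 =
      (paramFirstForm Ψ v).det := by
    rw [hsq, Matrix.det_fin_two]; rfl
  rw [trace_inv_mul_fin_two]
  simp only [paramMeanSq, paramSecondForm_tripleProduct hn horth]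
  rw [div_pow, div_eq_div_iff (by positivity) (by positivity), ← hsq']
  ring

/-- The matrix of the derivative of a change of parameters. -/
noncomputable def jacobianMatrix (σ : E2 → E2) (v : E2) : Matrix (Fin 2) (Fin 2) ℝ :=
  Matrix.of fun k i => (fderiv ℝ σ v (stdE2 i)) k

theorem eq_sum_stdE2 (w : E2) : w = w 0 • stdE2 0 + w 1 • stdE2 1 := by
  ext k; fin_cases k <;> simp

/-- Under a change of parameters `φ = Ψ ∘ σ` at a point where `φ` is immersed, `Ψ` is immersed
with the same unit normals, and its curvature functions agree with those of `φ`. -/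
theorem param_change {σ : E2 → E2} (hσ : ContDiffAt ℝ 2 σ v) (hΨ : ContDiffAt ℝ 2 Ψ (σ v))
    (e : φ =ᶠ[𝓝 v] fun w => Ψ (σ w)) (hinj : Injective (fderiv ℝ φ v)) (hn : ‖n‖ = 1)
    (horth : ∀ w, inner ℝ (fderiv ℝ φ v w) n = 0) :
    Injective (fderiv ℝ Ψ (σ v)) ∧ (∀ w, inner ℝ (fderiv ℝ Ψ (σ v) w) n = 0) ∧
      paramGauss φ v = paramGauss Ψ (σ v) ∧ paramMeanSq φ v = paramMeanSq Ψ (σ v) := by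
  obtain ⟨h1, h2⟩ := fderiv_comp_param hσ hΨ e
  have hσinj : Injective (fderiv ℝ σ v) := fun a b hab => hinj (by rw [h1, h1, hab])
  have hσsurj : Surjective (fderiv ℝ σ v) :=
    (LinearMap.injective_iff_surjective (f := (fderiv ℝ σ v : E2 →ₗ[ℝ] E2))).1 hσinj
  have hΨinj : Injective (fderiv ℝ Ψ (σ v)) := by
    intro a b hab
    obtain ⟨a, rfl⟩ := hσsurj a
    obtain ⟨b, rfl⟩ := hσsurj b
    rw [← h1, ← h1] at hab
    rw [hinj hab]
  have hΨorth : ∀ w, inner ℝ (fderiv ℝ Ψ (σ v) w) n = 0 := by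
    intro w
    obtain ⟨a, rfl⟩ := hσsurj w
    rw [← h1]; exact horth a
  set J := jacobianMatrix σ v with hJ
  have hstd : ∀ i, fderiv ℝ σ v (stdE2 i) = J 0 i • stdE2 0 + J 1 i • stdE2 1 := fun i =>
    eq_sum_stdE2 _
  have hI : paramFirstForm φ v = J.transpose * paramFirstForm Ψ (σ v) * J := by
    ext i j
    simp only [paramFirstForm, Matrix.of_apply, h1, hstd, map_add, map_smul, inner_add_left,
      inner_add_right, real_inner_smul_left, real_inner_smul_right, Matrix.mul_apply,
      Fin.sum_univ_two, Matrix.transpose_apply]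
    ring
  have hII : paramSecondForm φ v n = J.transpose * paramSecondForm Ψ (σ v) n * J := by
    ext i j
    simp only [paramSecondForm, Matrix.of_apply, h2, hstd, map_add, map_smul, inner_add_left,
      real_inner_smul_left, Matrix.mul_apply, hΨorth, add_apply, smul_apply,
      Fin.sum_univ_two, Matrix.transpose_apply]
    ring
  have hdet : J.det ≠ 0 := by
    intro h0
    have := paramFirstForm_det_pos hinj
    rw [hI] at this
    simp [h0] at this
  refine ⟨hΨinj, hΨorth, ?_, ?_⟩
  · rw [paramGauss_eq hinj hn horth, paramGauss_eq hΨinj hn hΨorth, hI, hII]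
    have := (paramFirstForm_det_pos hΨinj).ne'
    simp only [Matrix.det_mul, Matrix.det_transpose]
    field_simp
  · rw [paramMeanSq_eq hinj hn horth, paramMeanSq_eq hΨinj hn hΨorth, hI, hII]
    congr 1
    have hu : IsUnit J.det := isUnit_iff_ne_zero.2 hdet
    have hu' : IsUnit J.transpose.det := by rwa [Matrix.det_transpose]
    rw [Matrix.mul_inv_rev, Matrix.mul_inv_rev, Matrix.trace_mul_comm]
    simp only [Matrix.mul_assoc]
    rw [Matrix.mul_nonsing_inv_cancel_left _ _ hu, Matrix.trace_mul_comm]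
    simp only [Matrix.mul_assoc]
    rw [Matrix.nonsing_inv_mul _ hu', Matrix.mul_one, Matrix.trace_mul_comm]

/-- The sum and the product of the principal radii in terms of the curvature functions. -/
theorem principalRadii_sum_sq_and_mul {X : S2 → E3} {p : S2} {r₁ r₂ : ℝ}
    (hinj : Injective (fderiv ℝ (localParam X p) (coordAt p))) (hn : ‖n‖ = 1)
    (horth : ∀ w, inner ℝ (fderiv ℝ (localParam X p) (coordAt p) w) n = 0)
    (hK : 0 < paramGauss (localParam X p) (coordAt p)) (hr : ArePrincipalRadii X p n r₁ r₂) :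
    (r₁ + r₂) ^ 2 = paramMeanSq (localParam X p) (coordAt p) /
      paramGauss (localParam X p) (coordAt p) ^ 2 ∧
    r₁ * r₂ = 1 / paramGauss (localParam X p) (coordAt p) := by
  have hg := paramFirstForm_det_pos hinj
  have hK' := paramGauss_eq hinj hn horth
  have hM := paramMeanSq_eq hinj hn horth
  unfold ArePrincipalRadii at hr
  change ((paramSecondForm (localParam X p) (coordAt p) n)⁻¹ *
    paramFirstForm (localParam X p) (coordAt p)).charpoly = _ at hr
  set h := paramSecondForm (localParam X p) (coordAt p) n
  set g := paramFirstForm (localParam X p) (coordAt p)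
  rw [hK'] at hK ⊢
  rw [hM]
  have hh : 0 < h.det := (div_pos_iff_of_pos_right hg).1 hK
  rw [Matrix.charpoly_fin_two] at hr
  have e0 := congrArg (Polynomial.eval 0) hr
  have e1 := congrArg (Polynomial.eval 1) hr
  simp only [Polynomial.eval_add, Polynomial.eval_sub, Polynomial.eval_mul, Polynomial.eval_pow,
    Polynomial.eval_X, Polynomial.eval_C] at e0 e1
  have hsum : r₁ + r₂ = (h⁻¹ * g).trace := by linarith
  have hprod : r₁ * r₂ = (h⁻¹ * g).det := by linarith
  rw [hsum, hprod, trace_inv_mul_fin_two, trace_inv_mul_fin_two, Matrix.det_mul,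
    Matrix.det_nonsing_inv, Ring.inverse_eq_inv']
  constructor
  · field_simp
    ring
  · field_simp

end ParametrizedSurfaces

/-! ### Local graph representation -/

section LocalGraph

/-- The coordinates of the projection to the plane spanned by the first two vectors of an
orthonormal frame. -/
noncomputable def frameProj (e : OrthonormalBasis (Fin 3) ℝ E3) : E3 →L[ℝ] E2 :=
  ((EuclideanSpace.equiv (Fin 2) ℝ).symm : (Fin 2 → ℝ) →L[ℝ] E2).comp
    (ContinuousLinearMap.pi fun i : Fin 2 => innerSL ℝ (e i.castSucc))

/-- The inclusion of the plane spanned by the first two vectors of an orthonormal frame. -/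
noncomputable def frameLift (e : OrthonormalBasis (Fin 3) ℝ E3) : E2 →L[ℝ] E3 :=
  (EuclideanSpace.proj (0 : Fin 2) : E2 →L[ℝ] ℝ).smulRight (e 0) +
    (EuclideanSpace.proj (1 : Fin 2) : E2 →L[ℝ] ℝ).smulRight (e 1)

theorem frameProj_apply (e : OrthonormalBasis (Fin 3) ℝ E3) (y : E3) (i : Fin 2) :
    frameProj e y i = inner ℝ (e i.castSucc) y := rfl

theorem frameLift_apply (e : OrthonormalBasis (Fin 3) ℝ E3) (v : E2) :
    frameLift e v = v 0 • e 0 + v 1 • e 1 := rfl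

theorem frame_decomp (e : OrthonormalBasis (Fin 3) ℝ E3) (y : E3) :
    y = frameLift e (frameProj e y) + (inner ℝ (e 2) y : ℝ) • e 2 := by
  conv_lhs => rw [← e.sum_repr' y, Fin.sum_univ_three]
  rfl

theorem inner_frame (e : OrthonormalBasis (Fin 3) ℝ E3) (i j : Fin 3) :
    inner ℝ (e i) (e j) = if i = j then (1 : ℝ) else 0 :=
  orthonormal_iff_ite.1 e.orthonormal i j

/-- The point of the graph of `u` (at time `z.1`) above the point `z.2` of the plane. -/
noncomputable def graphPoint (e : OrthonormalBasis (Fin 3) ℝ E3) (u : ℝ × E2 → ℝ) (z : ℝ × E2) :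
    E3 :=
  frameLift e z.2 + u z • e 2

/-- A moving surface, parametrized by `Y`, is near `(t₀, p₀)` the graph of the smooth function `u`
over the plane spanned by the first two vectors of `e`; the point above `(t, x)` is
`Y t (ξ (t, x))`. -/
structure IsLocalGraph (Y : ℝ → S2 → E3) (t₀ : ℝ) (p₀ : S2) (e : OrthonormalBasis (Fin 3) ℝ E3)
    (u : ℝ × E2 → ℝ) (ξ : ℝ × E2 → S2) : Prop where
  smooth : ContDiffAt ℝ ∞ u (t₀, frameProj e (Y t₀ p₀))
  base : ξ (t₀, frameProj e (Y t₀ p₀)) = p₀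
  cont : ContinuousAt ξ (t₀, frameProj e (Y t₀ p₀))
  cont_surface : ContinuousAt (uncurry Y) (t₀, p₀)
  graph : ∀ᶠ z in 𝓝 (t₀, frameProj e (Y t₀ p₀)), Y z.1 (ξ z) = graphPoint e u z
  mem_graph : ∀ᶠ q : ℝ × S2 in 𝓝 (t₀, p₀),
    Y q.1 q.2 = graphPoint e u (q.1, frameProj e (Y q.1 q.2))

theorem exists_isLocalGraph {Y : ℝ → S2 → E3} {t₀ : ℝ} {p₀ : S2}
    (hY : ContDiffAt ℝ ∞ (fun q : ℝ × E2 => localParam (Y q.1) p₀ q.2) (t₀, coordAt p₀))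
    (hinj : Injective (fderiv ℝ (localParam (Y t₀) p₀) (coordAt p₀)))
    (e : OrthonormalBasis (Fin 3) ℝ E3)
    (he : ∀ w, inner ℝ (fderiv ℝ (localParam (Y t₀) p₀) (coordAt p₀) w) (e 2) = 0) :
    ∃ u ξ, IsLocalGraph Y t₀ p₀ e u ξ := by
  set ψ : ℝ × E2 → E3 := fun q => localParam (Y q.1) p₀ q.2 with hψ
  have hsymm : (chartAt E2 p₀).symm (coordAt p₀) = p₀ :=
    (chartAt E2 p₀).left_inv (mem_chart_source E2 p₀)
  have hψ0 : ψ (t₀, coordAt p₀) = Y t₀ p₀ := by simp only [hψ, localParam, hsymm]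
  set Θ : ℝ × E2 → ℝ × E2 := fun q => (q.1, frameProj e (ψ q)) with hΘ
  have hΘ0 : Θ (t₀, coordAt p₀) = (t₀, frameProj e (Y t₀ p₀)) := by simp only [hΘ, hψ0]
  have hΘs : ContDiffAt ℝ ∞ Θ (t₀, coordAt p₀) :=
    contDiffAt_fst.prodMk ((frameProj e).contDiff.contDiffAt.comp _ hY)
  have hψd : HasFDerivAt ψ (fderiv ℝ ψ (t₀, coordAt p₀)) (t₀, coordAt p₀) :=
    (hY.differentiableAt (by simp)).hasFDerivAt
  have hslice : ∀ w, fderiv ℝ ψ (t₀, coordAt p₀) (0, w) =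
      fderiv ℝ (localParam (Y t₀) p₀) (coordAt p₀) w := by
    intro w
    have h1 : HasFDerivAt (fun v : E2 => (t₀, v)) (ContinuousLinearMap.inr ℝ ℝ E2) (coordAt p₀) :=
      hasFDerivAt_prodMk_right t₀ _
    have h2 : HasFDerivAt (localParam (Y t₀) p₀) _ (coordAt p₀) := hψd.comp (coordAt p₀) h1
    rw [h2.fderiv]; rfl
  set A : ℝ × E2 →L[ℝ] ℝ × E2 := (ContinuousLinearMap.fst ℝ ℝ E2).prod
    ((frameProj e).comp (fderiv ℝ ψ (t₀, coordAt p₀))) with hA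
  have hAd : HasFDerivAt Θ A (t₀, coordAt p₀) :=
    hasFDerivAt_fst.prodMk ((frameProj e).hasFDerivAt.comp _ hψd)
  have hAinj : Injective A := by
    rw [injective_iff_map_eq_zero]
    rintro ⟨s, w⟩ h0
    have hs : s = 0 := congrArg Prod.fst h0
    subst hs
    have hw : frameProj e (fderiv ℝ ψ (t₀, coordAt p₀) (0, w)) = 0 := congrArg Prod.snd h0
    have hd := frame_decomp e (fderiv ℝ ψ (t₀, coordAt p₀) (0, w))
    rw [hw, hslice, real_inner_comm, he] at hd
    have : fderiv ℝ (localParam (Y t₀) p₀) (coordAt p₀) w =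
      fderiv ℝ (localParam (Y t₀) p₀) (coordAt p₀) 0 := by rw [hd]; simp
    rw [hinj this]; rfl
  set A' : (ℝ × E2) ≃L[ℝ] (ℝ × E2) :=
    (LinearEquiv.ofInjectiveEndo (A : ℝ × E2 →ₗ[ℝ] ℝ × E2) hAinj).toContinuousLinearEquiv with hA'
  have hAA' : (A' : ℝ × E2 →L[ℝ] ℝ × E2) = A := by ext x <;> rfl
  have hAd' : HasFDerivAt Θ (A' : ℝ × E2 →L[ℝ] ℝ × E2) (t₀, coordAt p₀) := by rw [hAA']; exact hAd
  have hstrict : HasStrictFDerivAt Θ (A' : ℝ × E2 →L[ℝ] ℝ × E2) (t₀, coordAt p₀) :=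
    hΘs.hasStrictFDerivAt' hAd' (by simp)
  have hinvs : ContDiffAt ℝ ∞ (hstrict.localInverse Θ A' (t₀, coordAt p₀))
      (Θ (t₀, coordAt p₀)) := hΘs.to_localInverse hAd' (by simp)
  have hleft := hstrict.eventually_left_inverse
  have hright := hstrict.eventually_right_inverse
  have himg : hstrict.localInverse Θ A' (t₀, coordAt p₀) (Θ (t₀, coordAt p₀)) = (t₀, coordAt p₀) :=
    hstrict.localInverse_apply_image
  set inv := hstrict.localInverse Θ A' (t₀, coordAt p₀) with hinv
  have hc : ContinuousAt (fun q : ℝ × S2 => (q.1, chartAt E2 p₀ q.2)) (t₀, p₀) :=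
      continuousAt_fst.prodMk (ContinuousAt.comp
        ((chartAt E2 p₀).continuousAt (mem_chart_source E2 p₀)) continuousAt_snd)
  have hsrc : ∀ᶠ q : ℝ × S2 in 𝓝 (t₀, p₀), q.2 ∈ (chartAt E2 p₀).source :=
      continuousAt_snd.eventually (chart_source_mem_nhds E2 p₀)
  have hYc : ContinuousAt (uncurry Y) (t₀, p₀) := by
    have h1 : ContinuousAt (ψ ∘ fun q : ℝ × S2 => (q.1, chartAt E2 p₀ q.2)) (t₀, p₀) :=
      ContinuousAt.comp (f := fun q : ℝ × S2 => (q.1, chartAt E2 p₀ q.2)) hY.continuousAt hc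
    refine h1.congr ?_
    filter_upwards [hsrc] with q hqs
    simp only [hψ, localParam, comp_apply, (chartAt E2 p₀).left_inv hqs]
    rfl
  refine ⟨fun z => inner ℝ (e 2) (ψ (inv z)), fun z => (chartAt E2 p₀).symm (inv z).2, ?_, ?_, ?_,
    hYc, ?_, ?_⟩
  · rw [← hΘ0]
    have h1 : ContDiffAt ℝ ∞ (ψ ∘ inv) (Θ (t₀, coordAt p₀)) := by
      refine ContDiffAt.comp _ ?_ hinvs
      rw [himg]; exact hY
    exact contDiffAt_const.inner ℝ h1
  · rw [← hΘ0, himg]; exact hsymm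
  · rw [← hΘ0]
    refine ContinuousAt.comp (g := (chartAt E2 p₀).symm) ?_
      (continuousAt_snd.comp hinvs.continuousAt)
    rw [himg]
    exact (chartAt E2 p₀).continuousAt_symm (mem_chart_target E2 p₀)
  · rw [← hΘ0]
    filter_upwards [hright] with z hz
    have h1 : (inv z).1 = z.1 := by change (Θ (inv z)).1 = z.1; rw [hz]
    have h2 : frameProj e (ψ (inv z)) = z.2 := by change (Θ (inv z)).2 = z.2; rw [hz]
    have h3 : Y z.1 ((chartAt E2 p₀).symm (inv z).2) = ψ (inv z) := by
      simp only [hψ, localParam, h1]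
    rw [h3, graphPoint, ← h2]
    exact frame_decomp e _
  · filter_upwards [hc.eventually hleft, hsrc] with q hq hqs
    have h1 : ψ (q.1, chartAt E2 p₀ q.2) = Y q.1 q.2 := by
      simp only [hψ, localParam, (chartAt E2 p₀).left_inv hqs]
    have h2 : Θ (q.1, chartAt E2 p₀ q.2) = (q.1, frameProj e (Y q.1 q.2)) := by
      simp only [hΘ, h1]
    rw [h2] at hq
    rw [graphPoint]
    change _ = _ + (inner ℝ (e 2) (ψ (inv (q.1, frameProj e (Y q.1 q.2)))) : ℝ) • e 2
    rw [hq, h1]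
    exact frame_decomp e _

end LocalGraph

/-! ### Geometry of graphs -/

section GraphGeometry

/-- The space-time directions of the two coordinates of the parameter plane. -/
noncomputable abbrev spaceDir (i : Fin 2) : ℝ × E2 := (0, stdE2 i)

theorem dirDeriv_decomp {V : Type*} [NormedAddCommGroup V] [NormedSpace ℝ V] (f : ℝ × V → ℝ)
    (z : ℝ × V) (w : V) : dirDeriv (1, w) f z = dirDeriv (1, 0) f z + dirDeriv (0, w) f z := by
  unfold dirDeriv
  rw [← map_add]; simp

theorem dirDeriv_space (f : ℝ × E2 → ℝ) (z : ℝ × E2) (w : E2) : dirDeriv (0, w) f z =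
    w 0 * dirDeriv (spaceDir 0) f z + w 1 * dirDeriv (spaceDir 1) f z := by
  have : ((0 : ℝ), w) = w 0 • spaceDir 0 + w 1 • spaceDir 1 := by
    ext i
    · simp
    · fin_cases i <;> simp
  unfold dirDeriv
  rw [this, map_add, map_smul, map_smul]; rfl

variable {e : OrthonormalBasis (Fin 3) ℝ E3} {u : ℝ × E2 → ℝ} {z : ℝ × E2}

theorem graphPoint_slice_contDiffAt (hu : ContDiffAt ℝ 2 u z) :
    ContDiffAt ℝ 2 (fun v => graphPoint e u (z.1, v)) z.2 := by
  have h1 : ContDiffAt ℝ 2 (fun v : E2 => u (z.1, v)) z.2 :=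
    ContDiffAt.comp (f := fun v : E2 => (z.1, v)) (g := u) z.2 hu
      (contDiffAt_const.prodMk contDiffAt_id)
  exact ((frameLift e).contDiff.contDiffAt).add (h1.smul contDiffAt_const)

theorem hasFDerivAt_slice {f : ℝ × E2 → ℝ} (hf : DifferentiableAt ℝ f z) :
    HasFDerivAt (fun v : E2 => f (z.1, v))
      ((fderiv ℝ f z).comp (ContinuousLinearMap.inr ℝ ℝ E2)) z.2 :=
  HasFDerivAt.comp (f := fun v : E2 => (z.1, v)) (g := f) z.2 hf.hasFDerivAt
    (hasFDerivAt_prodMk_right z.1 z.2)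

theorem fderiv_graphPoint_apply (hu : DifferentiableAt ℝ u z) (w : E2) :
    fderiv ℝ (fun v => graphPoint e u (z.1, v)) z.2 w =
      frameLift e w + dirDeriv (0, w) u z • e 2 := by
  have h := (frameLift e).hasFDerivAt.add ((hasFDerivAt_slice hu).smul_const (e 2))
  have : fderiv ℝ (fun v => graphPoint e u (z.1, v)) z.2 = _ := h.fderiv
  rw [this]
  rfl

theorem fderiv_fderiv_graphPoint_apply (hu : ContDiffAt ℝ 2 u z) (w w' : E2) :
    fderiv ℝ (fderiv ℝ (fun v => graphPoint e u (z.1, v))) z.2 w w' =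
      dirDeriv (0, w) (dirDeriv (0, w') u) z • e 2 := by
  have h2 := graphPoint_slice_contDiffAt (e := e) hu
  have hd : DifferentiableAt ℝ (fderiv ℝ (fun v => graphPoint e u (z.1, v))) z.2 :=
    (h2.fderiv_right (m := 1) (by norm_num)).differentiableAt (by simp)
  have h3 : fderiv ℝ (fderiv ℝ (fun v => graphPoint e u (z.1, v))) z.2 w w' =
      fderiv ℝ (fun v => fderiv ℝ (fun v => graphPoint e u (z.1, v)) v w') z.2 w := by
    rw [fderiv_clm_apply hd (differentiableAt_const w')]
    simp
  have hev : ∀ᶠ v in 𝓝 z.2, DifferentiableAt ℝ u (z.1, v) := by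
    have hc : Tendsto (fun v : E2 => (z.1, v)) (𝓝 z.2) (𝓝 z) :=
      (continuous_const.prodMk continuous_id).tendsto z.2
    filter_upwards [hc.eventually (hu.eventually (by simp))] with v hv
    exact hv.differentiableAt (by simp)
  have h4 : (fun v => fderiv ℝ (fun v => graphPoint e u (z.1, v)) v w') =ᶠ[𝓝 z.2]
      fun v => frameLift e w' + dirDeriv (0, w') u (z.1, v) • e 2 := by
    filter_upwards [hev] with v hv
    exact fderiv_graphPoint_apply (z := (z.1, v)) hv w'
  have h5 : DifferentiableAt ℝ (dirDeriv (0, w') u) z :=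
    (((hu.fderiv_right (m := 1) (by norm_num)).clm_apply
      contDiffAt_const).differentiableAt (by simp))
  rw [h3, h4.fderiv_eq, (((hasFDerivAt_slice h5).smul_const (e 2)).const_add _).fderiv]
  rfl

theorem frameProj_frameLift (w : E2) : frameProj e (frameLift e w) = w := by
  ext i
  rw [frameProj_apply, frameLift_apply, inner_add_right, real_inner_smul_right,
    real_inner_smul_right, inner_frame, inner_frame]
  fin_cases i <;> simp

theorem frameProj_last : frameProj e (e 2) = 0 := by
  ext i
  rw [frameProj_apply, inner_frame]
  fin_cases i <;> simp

theorem injective_fderiv_graphPoint (hu : DifferentiableAt ℝ u z) :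
    Injective (fderiv ℝ (fun v => graphPoint e u (z.1, v)) z.2) := by
  intro a b hab
  rw [fderiv_graphPoint_apply hu, fderiv_graphPoint_apply hu] at hab
  simpa [frameProj_frameLift, frameProj_last] using congrArg (frameProj e) hab

/-- A unit normal of a graph has frame coordinates proportional to `(-∇u, 1)`. -/
theorem graph_normal_coords (hu : DifferentiableAt ℝ u z) {n : E3} (hn : ‖n‖ = 1)
    (horth : ∀ w, inner ℝ (fderiv ℝ (fun v => graphPoint e u (z.1, v)) z.2 w) n = 0) :
    inner ℝ (e 0) n = -dirDeriv (spaceDir 0) u z * inner ℝ (e 2) n ∧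
    inner ℝ (e 1) n = -dirDeriv (spaceDir 1) u z * inner ℝ (e 2) n ∧
    (inner ℝ (e 2) n : ℝ) ^ 2 *
      graphArea (dirDeriv (spaceDir 0) u z) (dirDeriv (spaceDir 1) u z) = 1 := by
  have h0 := horth (stdE2 0)
  have h1 := horth (stdE2 1)
  rw [fderiv_graphPoint_apply hu, frameLift_apply] at h0 h1
  simp only [inner_add_left, real_inner_smul_left] at h0 h1
  simp at h0 h1
  have hs := e.sum_sq_norm_inner_right n
  rw [Fin.sum_univ_three, hn] at hs
  simp only [Real.norm_eq_abs, sq_abs] at hs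
  have h0' : inner ℝ (e 0) n = -dirDeriv (spaceDir 0) u z * inner ℝ (e 2) n := by linarith
  have h1' : inner ℝ (e 1) n = -dirDeriv (spaceDir 1) u z * inner ℝ (e 2) n := by linarith
  refine ⟨h0', h1', ?_⟩
  rw [h0', h1'] at hs
  unfold graphArea
  linarith

theorem exists_graph_normal (hu : DifferentiableAt ℝ u z) : ∃ n : E3, ‖n‖ = 1 ∧
    ∀ w, inner ℝ (fderiv ℝ (fun v => graphPoint e u (z.1, v)) z.2 w) n = 0 := by
  set m : E3 := e 2 - dirDeriv (spaceDir 0) u z • e 0 - dirDeriv (spaceDir 1) u z • e 1 with hm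
  have hm0 : m ≠ 0 := by
    intro h0
    have : (inner ℝ (e 2) m : ℝ) = 0 := by rw [h0, inner_zero_right]
    rw [hm, inner_sub_right, inner_sub_right, real_inner_smul_right, real_inner_smul_right,
      inner_frame, inner_frame, inner_frame] at this
    simp at this
  refine ⟨‖m‖⁻¹ • m,
    by rw [norm_smul, norm_inv, norm_norm, inv_mul_cancel₀ (norm_ne_zero_iff.2 hm0)], fun w => ?_⟩
  rw [real_inner_smul_right, fderiv_graphPoint_apply hu, frameLift_apply, dirDeriv_space, hm]
  simp only [inner_add_left, inner_sub_right, real_inner_smul_left, real_inner_smul_right,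
    inner_frame]
  simp
  right
  ring

theorem paramForms_graphPoint (hu : ContDiffAt ℝ 2 u z) (n : E3) :
    paramFirstForm (fun v => graphPoint e u (z.1, v)) z.2 =
      !![1 + dirDeriv (spaceDir 0) u z ^ 2, dirDeriv (spaceDir 0) u z * dirDeriv (spaceDir 1) u z;
        dirDeriv (spaceDir 0) u z * dirDeriv (spaceDir 1) u z, 1 + dirDeriv (spaceDir 1) u z ^ 2] ∧
    paramSecondForm (fun v => graphPoint e u (z.1, v)) z.2 n =
      (-inner ℝ (e 2) n : ℝ) • !![dirDeriv (spaceDir 0) (dirDeriv (spaceDir 0) u) z,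
        dirDeriv (spaceDir 0) (dirDeriv (spaceDir 1) u) z;
        dirDeriv (spaceDir 0) (dirDeriv (spaceDir 1) u) z,
        dirDeriv (spaceDir 1) (dirDeriv (spaceDir 1) u) z] := by
  have hu1 : DifferentiableAt ℝ u z := hu.differentiableAt (by simp)
  have hsym : dirDeriv (spaceDir 1) (dirDeriv (spaceDir 0) u) z =
      dirDeriv (spaceDir 0) (dirDeriv (spaceDir 1) u) z := by
    have hs : IsSymmSndFDerivAt ℝ u z := hu.isSymmSndFDerivAt (by simp)
    rw [dirDeriv_dirDeriv hu, dirDeriv_dirDeriv hu]; exact hs _ _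
  constructor
  · ext i j
    simp only [paramFirstForm, Matrix.of_apply, fderiv_graphPoint_apply hu1, frameLift_apply,
      inner_add_left, inner_add_right, real_inner_smul_left, real_inner_smul_right, inner_frame]
    fin_cases i <;> fin_cases j <;> simp <;> ring
  · ext i j
    simp only [paramSecondForm, Matrix.of_apply, fderiv_fderiv_graphPoint_apply hu,
      real_inner_smul_left, Matrix.smul_apply, smul_eq_mul]
    fin_cases i <;> fin_cases j <;> simp [hsym] <;> ring

/-- The squared mean curvature of the graph of `u`. -/
noncomputable def meanSqOfGraph {V : Type*} [NormedAddCommGroup V] [NormedSpace ℝ V] (ex ey : V)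
    (u : V → ℝ) (ζ : V) : ℝ :=
  graphMeanSq (dirDeriv ex u ζ) (dirDeriv ey u ζ) (dirDeriv ex (dirDeriv ex u) ζ)
    (dirDeriv ex (dirDeriv ey u) ζ) (dirDeriv ey (dirDeriv ey u) ζ)

theorem graphArea_pos (p q : ℝ) : 0 < graphArea p q := by unfold graphArea; positivity

theorem param_graphPoint (hu : ContDiffAt ℝ 2 u z) :
    paramGauss (fun v => graphPoint e u (z.1, v)) z.2 =
      gaussOfGraph (spaceDir 0) (spaceDir 1) u z ∧
    paramMeanSq (fun v => graphPoint e u (z.1, v)) z.2 =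
      meanSqOfGraph (spaceDir 0) (spaceDir 1) u z := by
  have hu1 : DifferentiableAt ℝ u z := hu.differentiableAt (by simp)
  obtain ⟨n, hn, horth⟩ := exists_graph_normal (e := e) hu1
  obtain ⟨-, -, hl⟩ := graph_normal_coords hu1 hn horth
  obtain ⟨hI, hII⟩ := paramForms_graphPoint (e := e) hu n
  have hinj := injective_fderiv_graphPoint (e := e) hu1
  have hw := graphArea_pos (dirDeriv (spaceDir 0) u z) (dirDeriv (spaceDir 1) u z)
  rw [paramGauss_eq hinj hn horth, paramMeanSq_eq hinj hn horth, trace_inv_mul_fin_two, hI, hII]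
  unfold gaussOfGraph meanSqOfGraph graphGauss graphMeanSq
  have r2 : ∀ w : ℝ, w ^ (-2 : ℝ) = (w ^ 2)⁻¹ := fun w => by
    rw [show (-2 : ℝ) = ((-2 : ℤ) : ℝ) by norm_num, Real.rpow_intCast]; rfl
  have r3 : ∀ w : ℝ, w ^ (-3 : ℝ) = (w ^ 3)⁻¹ := fun w => by
    rw [show (-3 : ℝ) = ((-3 : ℤ) : ℝ) by norm_num, Real.rpow_intCast]; rfl
  rw [r2, r3]
  have hdet : ∀ p q : ℝ, Matrix.det !![1 + p ^ 2, p * q; p * q, 1 + q ^ 2] = graphArea p q := by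
    intro p q; rw [Matrix.det_fin_two]; simp [graphArea]; ring
  rw [hdet]
  generalize graphArea _ _ = W at *
  generalize (inner ℝ (e 2) n : ℝ) = l at *
  constructor
  · rw [Matrix.det_fin_two]
    simp only [Matrix.smul_apply, smul_eq_mul, Matrix.of_apply, Matrix.cons_val_zero,
      Matrix.cons_val_one, Matrix.cons_val', Matrix.cons_val_fin_one]
    field_simp
    linear_combination (dirDeriv (spaceDir 0) (dirDeriv (spaceDir 0) u) z *
      dirDeriv (spaceDir 1) (dirDeriv (spaceDir 1) u) z -
      dirDeriv (spaceDir 0) (dirDeriv (spaceDir 1) u) z ^ 2) * hl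
  · simp only [Matrix.smul_apply, smul_eq_mul, Matrix.of_apply, Matrix.cons_val_zero,
      Matrix.cons_val_one, Matrix.cons_val', Matrix.cons_val_fin_one]
    field_simp
    linear_combination ((1 + dirDeriv (spaceDir 1) u z ^ 2) *
      dirDeriv (spaceDir 0) (dirDeriv (spaceDir 0) u) z -
      2 * (dirDeriv (spaceDir 0) u z * dirDeriv (spaceDir 1) u z *
        dirDeriv (spaceDir 0) (dirDeriv (spaceDir 1) u) z) +
      (1 + dirDeriv (spaceDir 0) u z ^ 2) *
        dirDeriv (spaceDir 1) (dirDeriv (spaceDir 1) u) z) ^ 2 * hl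

end GraphGeometry

/-! ### Smooth parametrizations and principal frames -/

section SmoothParametrizations

theorem chart_target_eq_univ (p : S2) : (chartAt E2 p).target = univ :=
  stereographic'_target (n := 2) (-p)

theorem contDiff_localParam {X : S2 → E3} (hX : ContMDiff (𝓡 2) 𝓘(ℝ, E3) ∞ X) (p : S2) :
    ContDiff ℝ ∞ (localParam X p) := by
  have h1 : ContMDiffOn (𝓡 2) (𝓡 2) ∞ (chartAt E2 p).symm (chartAt E2 p).target :=
    contMDiffOn_chart_symm
  have h2 := hX.comp_contMDiffOn h1
  rw [chart_target_eq_univ, contMDiffOn_univ] at h2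
  exact contMDiff_iff_contDiff.1 h2

theorem IsSmoothEmbeddedSphere.injective_fderiv {X : S2 → E3} (hX : IsSmoothEmbeddedSphere X)
    (p : S2) : Injective (fderiv ℝ (localParam X p) (coordAt p)) := by
  have h := hX.immersion p
  rw [(hX.smooth.mdifferentiable (by simp) p).mfderiv] at h
  simp only [writtenInExtChartAt, extChartAt, OpenPartialHomeomorph.extend,
    modelWithCornersSelf_partialEquiv, PartialEquiv.trans_refl, modelWithCornersSelf_coe,
    range_id, fderivWithin_univ, chartAt_self_eq, OpenPartialHomeomorph.refl_partialEquiv,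
    PartialEquiv.refl_coe] at h
  exact h

theorem contDiffOn_localParam {T : ℝ} {X : ℝ → S2 → E3}
    (hX : ContMDiffOn (𝓘(ℝ, ℝ).prod (𝓡 2)) 𝓘(ℝ, E3) ∞ (uncurry X) (Ico 0 T ×ˢ univ)) (p : S2) :
    ContDiffOn ℝ ∞ (fun q : ℝ × E2 => localParam (X q.1) p q.2) (Ico 0 T ×ˢ univ) := by
  have h1 : ContMDiffOn (𝓡 2) (𝓡 2) ∞ (chartAt E2 p).symm (chartAt E2 p).target :=
    contMDiffOn_chart_symm
  rw [chart_target_eq_univ] at h1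
  have h2 : ContMDiffOn 𝓘(ℝ, ℝ × E2) (𝓘(ℝ, ℝ).prod (𝓡 2)) ∞
      (fun q : ℝ × E2 => (q.1, (chartAt E2 p).symm q.2)) (Ico 0 T ×ˢ univ) := by
    refine ContMDiffOn.prodMk contDiff_fst.contMDiff.contMDiffOn ?_
    exact h1.comp contDiff_snd.contMDiff.contMDiffOn (fun q hq => hq.2)
  exact contMDiffOn_iff_contDiffOn.1 (hX.comp h2 fun q hq => ⟨hq.1, mem_univ _⟩)

/-- At `p` the surface `X` is twice differentiable and immersed with unit normal `n`; unlike for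
`IsOuterUnitNormal`, the side to which `n` points is not prescribed. -/
structure IsRegularAt (X : S2 → E3) (p : S2) (n : E3) : Prop where
  smooth : ContDiffAt ℝ 2 (localParam X p) (coordAt p)
  inj : Injective (fderiv ℝ (localParam X p) (coordAt p))
  norm : ‖n‖ = 1
  orth : ∀ w, inner ℝ (fderiv ℝ (localParam X p) (coordAt p) w) n = 0

theorem IsSmoothEmbeddedSphere.isRegularAt {X : S2 → E3} (hX : IsSmoothEmbeddedSphere X) {p : S2}
    {n : E3} (hn : IsOuterUnitNormal X p n) : IsRegularAt X p n :=
  ⟨((contDiff_localParam hX.smooth p).contDiffAt).of_le (by norm_cast), hX.injective_fderiv p,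
    hn.norm_eq_one, hn.orthogonal⟩

end SmoothParametrizations

section PrincipalFrames

theorem paramSecondForm_neg_of_posDef {φ : E2 → E3} {v : E2} {n : E3}
    (hpd : (paramSecondForm φ v n).PosDef) {x : E2} (hx : x ≠ 0) :
    inner ℝ (fderiv ℝ (fderiv ℝ φ) v x x) n < 0 := by
  have hx' : x.ofLp ≠ 0 := fun h => hx (by ext i; exact congrFun h i)
  have h := hpd.dotProduct_mulVec_pos hx'
  have e : inner ℝ (fderiv ℝ (fderiv ℝ φ) v x x) n =
      -(star x.ofLp ⬝ᵥ (paramSecondForm φ v n).mulVec x.ofLp) := by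
    conv_lhs => rw [eq_sum_stdE2 x]
    simp only [map_add, map_smul, add_apply, smul_apply, inner_add_left, real_inner_smul_left,
      dotProduct, Matrix.mulVec, Fin.sum_univ_two, paramSecondForm, Matrix.of_apply,
      Pi.star_apply, star_trivial]
    ring
  linarith

/-- Rotating a frame makes the off-diagonal entry of a symmetric form vanish. -/
theorem exists_rotation_diagonal (a b c : ℝ) :
    ∃ θ : ℝ, (Real.cos θ ^ 2 - Real.sin θ ^ 2) * c + Real.cos θ * Real.sin θ * (b - a) = 0 := by
  have hc : Continuous fun θ : ℝ =>
      (Real.cos θ ^ 2 - Real.sin θ ^ 2) * c + Real.cos θ * Real.sin θ * (b - a) := by fun_prop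
  -- the expression changes sign between `0` and `π / 2`
  rcases le_total 0 c with h | h
  · exact mem_range_of_exists_le_of_exists_ge hc ⟨Real.pi / 2, by simpa using h⟩
      ⟨0, by simpa using h⟩
  · exact mem_range_of_exists_le_of_exists_ge hc ⟨0, by simpa using h⟩
      ⟨Real.pi / 2, by simpa using h⟩

theorem exists_orthonormalBasis_of_triple {x y n : E3} (hxx : inner ℝ x x = (1 : ℝ))
    (hyy : inner ℝ y y = (1 : ℝ)) (hnn : inner ℝ n n = (1 : ℝ)) (hxy : inner ℝ x y = (0 : ℝ))
    (hxn : inner ℝ x n = (0 : ℝ)) (hyn : inner ℝ y n = (0 : ℝ)) :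
    ∃ e : OrthonormalBasis (Fin 3) ℝ E3, e 0 = x ∧ e 1 = y ∧ e 2 = n := by
  have ho : Orthonormal ℝ ![x, y, n] := by
    rw [orthonormal_iff_ite]
    have hu : ∀ {w : E3}, inner ℝ w w = (1 : ℝ) → ‖w‖ = 1 := fun h => by
      rw [norm_eq_sqrt_real_inner, h, Real.sqrt_one]
    have h1 := real_inner_comm x y
    have h2 := real_inner_comm x n
    have h3 := real_inner_comm y n
    intro i j
    fin_cases i <;> fin_cases j <;> simp [hu hxx, hu hyy, hu hnn, hxy, hxn, hyn, h1, h2, h3]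
  have hcard : Fintype.card (Fin 3) = Module.finrank ℝ E3 := by simp
  let e := OrthonormalBasis.mk ho
    (ho.linearIndependent.span_eq_top_of_card_eq_finrank hcard).ge
  refine ⟨e, ?_, ?_, ?_⟩ <;> simp [e]

/-- An orthonormal frame adapted to a locally convex surface: two principal directions and the
inner normal. -/
theorem exists_principal_frame {φ : E2 → E3} {v : E2} {n : E3} (hφ : ContDiffAt ℝ 2 φ v)
    (hinj : Injective (fderiv ℝ φ v)) (hn : ‖n‖ = 1)
    (horth : ∀ w, inner ℝ (fderiv ℝ φ v w) n = 0) (hpd : (paramSecondForm φ v n).PosDef) :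
    ∃ (e : OrthonormalBasis (Fin 3) ℝ E3) (x y : E2), e 2 = -n ∧ fderiv ℝ φ v x = e 0 ∧
      fderiv ℝ φ v y = e 1 ∧ inner ℝ (fderiv ℝ (fderiv ℝ φ) v x y) n = 0 ∧
      inner ℝ (fderiv ℝ (fderiv ℝ φ) v x x) n < 0 ∧
      inner ℝ (fderiv ℝ (fderiv ℝ φ) v y y) n < 0 := by
  have hsym : ∀ a b, inner ℝ (fderiv ℝ (fderiv ℝ φ) v a b) n =
      inner ℝ (fderiv ℝ (fderiv ℝ φ) v b a) n := fun a b => by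
    have hs : IsSymmSndFDerivAt ℝ φ v := hφ.isSymmSndFDerivAt (by simp)
    rw [hs a b]
  have hneg : ∀ {x}, x ≠ 0 → inner ℝ (fderiv ℝ (fderiv ℝ φ) v x x) n < 0 := fun hx =>
    paramSecondForm_neg_of_posDef hpd hx
  have hAz : ∀ {x}, x ≠ 0 → fderiv ℝ φ v x ≠ 0 := fun {x} hx h0 =>
    hx (hinj (by rw [h0, map_zero]))
  have hunit : ∀ {x}, x ≠ 0 → inner ℝ (fderiv ℝ φ v (‖fderiv ℝ φ v x‖⁻¹ • x))
      (fderiv ℝ φ v (‖fderiv ℝ φ v x‖⁻¹ • x)) = (1 : ℝ) := fun {x} hx => by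
    have := norm_ne_zero_iff.2 (hAz hx)
    rw [map_smul, real_inner_smul_left, real_inner_smul_right, real_inner_self_eq_norm_sq]
    field_simp
  have hs0 : stdE2 0 ≠ 0 := fun h => by simpa using congrArg (fun w : E2 => w 0) h
  obtain ⟨x₀, hx₀, c₀, hxc⟩ : ∃ x₀ : E2, inner ℝ (fderiv ℝ φ v x₀) (fderiv ℝ φ v x₀) = (1 : ℝ) ∧
      ∃ c : ℝ, x₀ = c • stdE2 0 := ⟨_, hunit hs0, _, rfl⟩
  obtain ⟨y₁, hy₁, hxy₁⟩ : ∃ y₁ : E2, y₁ ≠ 0 ∧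
      inner ℝ (fderiv ℝ φ v x₀) (fderiv ℝ φ v y₁) = (0 : ℝ) := by
    refine ⟨stdE2 1 - (inner ℝ (fderiv ℝ φ v x₀) (fderiv ℝ φ v (stdE2 1)) : ℝ) • x₀, ?_, ?_⟩
    · intro h
      have := congrArg (fun w : E2 => w 1) h
      rw [hxc] at this
      simp at this
    · rw [map_sub, map_smul, inner_sub_right, real_inner_smul_right, hx₀, mul_one, sub_self]
  obtain ⟨y₀, hy₀, hxy₀⟩ : ∃ y₀ : E2, inner ℝ (fderiv ℝ φ v y₀) (fderiv ℝ φ v y₀) = (1 : ℝ) ∧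
      inner ℝ (fderiv ℝ φ v x₀) (fderiv ℝ φ v y₀) = (0 : ℝ) :=
    ⟨_, hunit hy₁, by rw [map_smul, real_inner_smul_right, hxy₁, mul_zero]⟩
  have hyx₀ : inner ℝ (fderiv ℝ φ v y₀) (fderiv ℝ φ v x₀) = (0 : ℝ) := by
    rw [real_inner_comm, hxy₀]
  obtain ⟨θ, hθ⟩ := exists_rotation_diagonal (inner ℝ (fderiv ℝ (fderiv ℝ φ) v x₀ x₀) n)
    (inner ℝ (fderiv ℝ (fderiv ℝ φ) v y₀ y₀) n) (inner ℝ (fderiv ℝ (fderiv ℝ φ) v x₀ y₀) n)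
  have hcs := Real.sin_sq_add_cos_sq θ
  set c := Real.cos θ
  set s := Real.sin θ
  have hxx : inner ℝ (fderiv ℝ φ v (c • x₀ + s • y₀)) (fderiv ℝ φ v (c • x₀ + s • y₀)) =
      (1 : ℝ) := by
    simp only [map_add, map_smul, inner_add_left, inner_add_right, real_inner_smul_left,
      real_inner_smul_right, hx₀, hy₀, hxy₀, hyx₀]
    linarith
  have hyy : inner ℝ (fderiv ℝ φ v (-s • x₀ + c • y₀)) (fderiv ℝ φ v (-s • x₀ + c • y₀)) =
      (1 : ℝ) := by
    simp only [map_add, map_smul, inner_add_left, inner_add_right, real_inner_smul_left,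
      real_inner_smul_right, hx₀, hy₀, hxy₀, hyx₀]
    linarith
  have hxy : inner ℝ (fderiv ℝ φ v (c • x₀ + s • y₀)) (fderiv ℝ φ v (-s • x₀ + c • y₀)) =
      (0 : ℝ) := by
    simp only [map_add, map_smul, inner_add_left, inner_add_right, real_inner_smul_left,
      real_inner_smul_right, hx₀, hy₀, hxy₀, hyx₀]
    ring
  have hne : ∀ {x}, inner ℝ (fderiv ℝ φ v x) (fderiv ℝ φ v x) = (1 : ℝ) → x ≠ 0 := by
    rintro x h rfl
    simp at h
  obtain ⟨e, e0, e1, e2⟩ := exists_orthonormalBasis_of_triple hxx hyy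
    (n := -n) (by rw [inner_neg_neg, real_inner_self_eq_norm_sq, hn]; norm_num) hxy
    (by rw [inner_neg_right, horth, neg_zero]) (by rw [inner_neg_right, horth, neg_zero])
  refine ⟨e, _, _, e2, e0.symm, e1.symm, ?_, hneg (hne hxx), hneg (hne hyy)⟩
  simp only [map_add, map_smul, add_apply, smul_apply, inner_add_left, real_inner_smul_left]
  rw [hsym y₀ x₀]
  linarith

end PrincipalFrames

/-! ### Moving surfaces as graphs -/

section LocalGraphGeometry

variable {Y : ℝ → S2 → E3} {t₀ : ℝ} {p₀ : S2} {e : OrthonormalBasis (Fin 3) ℝ E3}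
  {u : ℝ × E2 → ℝ} {ξ : ℝ × E2 → S2}

namespace IsLocalGraph

theorem tendsto_proj (h : IsLocalGraph Y t₀ p₀ e u ξ) :
    Tendsto (fun q : ℝ × S2 => (q.1, frameProj e (Y q.1 q.2))) (𝓝 (t₀, p₀))
      (𝓝 (t₀, frameProj e (Y t₀ p₀))) := by
  have h1 : ContinuousAt (fun q : ℝ × S2 => frameProj e (uncurry Y q)) (t₀, p₀) :=
    (frameProj e).continuous.continuousAt.comp h.cont_surface
  exact continuousAt_fst.prodMk h1

theorem eventually_contDiffAt (h : IsLocalGraph Y t₀ p₀ e u ξ) :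
    ∀ᶠ z in 𝓝 (t₀, frameProj e (Y t₀ p₀)), ContDiffAt ℝ 2 u z :=
  (h.smooth.of_le (by norm_cast)).eventually (by simp)

/-- Near the base point every local parametrization of the surface factors through the graph. -/
theorem eventually_factor (h : IsLocalGraph Y t₀ p₀ e u ξ) :
    ∀ᶠ q : ℝ × S2 in 𝓝 (t₀, p₀), ∀ᶠ p in 𝓝 q.2,
      Y q.1 p = graphPoint e u (q.1, frameProj e (Y q.1 p)) := by
  filter_upwards [h.mem_graph.eventually_nhds] with q hq
  have hc : Tendsto (fun p : S2 => (q.1, p)) (𝓝 q.2) (𝓝 q) :=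
    (continuous_const.prodMk continuous_id).tendsto q.2
  exact hc.eventually hq

end IsLocalGraph

theorem eventually_chart_symm {p : S2} {P : S2 → Prop} (h : ∀ᶠ p' in 𝓝 p, P p') :
    ∀ᶠ v in 𝓝 (coordAt p), P ((chartAt E2 p).symm v) := by
  have hc := (chartAt E2 p).continuousAt_symm (mem_chart_target E2 p)
  have hsymm : (chartAt E2 p).symm (chartAt E2 p p) = p :=
    (chartAt E2 p).left_inv (mem_chart_source E2 p)
  unfold ContinuousAt at hc
  rw [hsymm] at hc
  exact hc.eventually h

theorem localParam_coordAt (X : S2 → E3) (p : S2) : localParam X p (coordAt p) = X p := by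
  simp only [localParam, coordAt, (chartAt E2 p).left_inv (mem_chart_source E2 p)]

/-- The curvature of a surface that is locally contained in the graph of `u` at time `t`. -/
theorem IsRegularAt.curvature_of_graph {X : S2 → E3} {p : S2} {n : E3} {t : ℝ}
    (hr : IsRegularAt X p n) (hu : ContDiffAt ℝ 2 u (t, frameProj e (X p)))
    (hX : ∀ᶠ p' in 𝓝 p, X p' = graphPoint e u (t, frameProj e (X p'))) :
    (∀ w, inner ℝ (fderiv ℝ (fun v => graphPoint e u (t, v)) (frameProj e (X p)) w) n = 0) ∧
    paramGauss (localParam X p) (coordAt p) =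
      gaussOfGraph (spaceDir 0) (spaceDir 1) u (t, frameProj e (X p)) ∧
    paramMeanSq (localParam X p) (coordAt p) =
      meanSqOfGraph (spaceDir 0) (spaceDir 1) u (t, frameProj e (X p)) := by
  set σ : E2 → E2 := fun v => frameProj e (localParam X p v) with hσ
  have hσ0 : σ (coordAt p) = frameProj e (X p) := by rw [hσ]; simp only [localParam_coordAt]
  have hσs : ContDiffAt ℝ 2 σ (coordAt p) :=
    (frameProj e).contDiff.contDiffAt.comp _ hr.smooth
  have hfac : localParam X p =ᶠ[𝓝 (coordAt p)] fun v => graphPoint e u (t, σ v) :=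
    eventually_chart_symm hX
  have hg : ContDiffAt ℝ 2 (fun v => graphPoint e u (t, v)) (σ (coordAt p)) := by
    rw [hσ0]; exact graphPoint_slice_contDiffAt hu
  obtain ⟨-, h2, h3, h4⟩ := param_change (Ψ := fun v => graphPoint e u (t, v)) hσs hg hfac hr.inj
    hr.norm hr.orth
  obtain ⟨g1, g2⟩ := param_graphPoint (e := e) hu
  rw [hσ0] at h2 h3 h4
  exact ⟨h2, h3.trans g1, h4.trans g2⟩

namespace IsLocalGraph

theorem eventually_curvature (h : IsLocalGraph Y t₀ p₀ e u ξ) :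
    ∀ᶠ q : ℝ × S2 in 𝓝 (t₀, p₀), ∀ n, IsRegularAt (Y q.1) q.2 n →
      (∀ w, inner ℝ (fderiv ℝ (fun v => graphPoint e u (q.1, v))
        (frameProj e (Y q.1 q.2)) w) n = 0) ∧
      paramGauss (localParam (Y q.1) q.2) (coordAt q.2) =
        gaussOfGraph (spaceDir 0) (spaceDir 1) u (q.1, frameProj e (Y q.1 q.2)) ∧
      paramMeanSq (localParam (Y q.1) q.2) (coordAt q.2) =
        meanSqOfGraph (spaceDir 0) (spaceDir 1) u (q.1, frameProj e (Y q.1 q.2)) := by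
  filter_upwards [h.tendsto_proj.eventually h.eventually_contDiffAt, h.eventually_factor]
    with q hq1 hq2 n hn
  exact hn.curvature_of_graph hq1 hq2

/-- The vertical velocity of the graph in terms of the velocity of the surface. -/
theorem eventually_velocity (h : IsLocalGraph Y t₀ p₀ e u ξ) :
    ∀ᶠ q : ℝ × S2 in 𝓝 (t₀, p₀), ∀ W : E3, HasDerivAt (fun s => Y s q.2) W q.1 →
      dirDeriv (1, 0) u (q.1, frameProj e (Y q.1 q.2)) = inner ℝ (e 2) W
        - dirDeriv (spaceDir 0) u (q.1, frameProj e (Y q.1 q.2)) * inner ℝ (e 0) W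
        - dirDeriv (spaceDir 1) u (q.1, frameProj e (Y q.1 q.2)) * inner ℝ (e 1) W := by
  filter_upwards [h.tendsto_proj.eventually h.eventually_contDiffAt, h.mem_graph.eventually_nhds]
    with q hq1 hq2 W hW
  have hc : Tendsto (fun s : ℝ => (s, q.2)) (𝓝 q.1) (𝓝 q) :=
    (continuous_id.prodMk continuous_const).tendsto q.1
  have hev : (fun s => (inner ℝ (e 2) (Y s q.2) : ℝ)) =ᶠ[𝓝 q.1]
      fun s => u (s, frameProj e (Y s q.2)) := by
    filter_upwards [hc.eventually hq2] with s hs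
    have : (inner ℝ (e 2) (Y s q.2) : ℝ) =
        inner ℝ (e 2) (graphPoint e u (s, frameProj e (Y s q.2))) := congrArg _ hs
    rw [this, graphPoint, frameLift_apply]
    simp only [inner_add_right, real_inner_smul_right, inner_frame]
    simp
  have d1 : HasDerivAt (fun s => (inner ℝ (e 2) (Y s q.2) : ℝ)) (inner ℝ (e 2) W) q.1 :=
    (innerSL ℝ (e 2)).hasFDerivAt.comp_hasDerivAt q.1 hW
  have d2 : HasDerivAt (fun s => (s, frameProj e (Y s q.2))) ((1 : ℝ), frameProj e W) q.1 :=
    (hasDerivAt_id q.1).prodMk ((frameProj e).hasFDerivAt.comp_hasDerivAt q.1 hW)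
  have d3 : HasDerivAt (fun s => u (s, frameProj e (Y s q.2)))
      (dirDeriv ((1 : ℝ), frameProj e W) u (q.1, frameProj e (Y q.1 q.2))) q.1 :=
    (hq1.differentiableAt (by simp)).hasFDerivAt.comp_hasDerivAt q.1 d2
  have key := d1.unique (d3.congr_of_eventuallyEq hev)
  rw [dirDeriv_decomp, dirDeriv_space, frameProj_apply, frameProj_apply] at key
  change (inner ℝ (e 2) W : ℝ) = _ + ((inner ℝ (e 0) W : ℝ) * _ + (inner ℝ (e 1) W : ℝ) * _) at key
  rw [key]; ring

/-- The point of the surface above a point of the plane near the base point. -/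
theorem tendsto_point (h : IsLocalGraph Y t₀ p₀ e u ξ) :
    Tendsto (fun z : ℝ × E2 => (z.1, ξ z)) (𝓝 (t₀, frameProj e (Y t₀ p₀))) (𝓝 (t₀, p₀)) := by
  have := continuousAt_fst.prodMk h.cont
  unfold ContinuousAt at this
  simp only [h.base] at this
  exact this

theorem eventually_proj_point (h : IsLocalGraph Y t₀ p₀ e u ξ) :
    ∀ᶠ z in 𝓝 (t₀, frameProj e (Y t₀ p₀)), (z.1, frameProj e (Y z.1 (ξ z))) = z := by
  filter_upwards [h.graph] with z hz
  rw [hz, graphPoint, map_add, map_smul, frameProj_frameLift, frameProj_last, smul_zero, add_zero]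

end IsLocalGraph

/-- A surface moving with normal velocity `-K ^ β ν` is, near a point where it is locally convex,
the graph of a solution of the graphical flow over principal directions. -/
theorem exists_convexGraphFlow {β : ℝ} {ν : ℝ → S2 → E3}
    (hY : ContDiffAt ℝ ∞ (fun q : ℝ × E2 => localParam (Y q.1) p₀ q.2) (t₀, coordAt p₀))
    (hreg : ∀ᶠ q : ℝ × S2 in 𝓝 (t₀, p₀), IsRegularAt (Y q.1) q.2 (ν q.1 q.2))
    (hpos : ∀ᶠ q : ℝ × S2 in 𝓝 (t₀, p₀), 0 < paramGauss (localParam (Y q.1) q.2) (coordAt q.2))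
    (hev : ∀ᶠ q : ℝ × S2 in 𝓝 (t₀, p₀), HasDerivAt (fun s => Y s q.2)
      (-(paramGauss (localParam (Y q.1) q.2) (coordAt q.2) ^ β) • ν q.1 q.2) q.1)
    (hpd : (paramSecondForm (localParam (Y t₀) p₀) (coordAt p₀) (ν t₀ p₀)).PosDef) :
    ∃ e u ξ a b, IsLocalGraph Y t₀ p₀ e u ξ ∧
      IsConvexGraphFlowAt β (spaceDir 0) (spaceDir 1) (1, 0) (t₀, frameProj e (Y t₀ p₀)) u a b := by
  have hr0 := hreg.self_of_nhds
  obtain ⟨e, x, y, he2, hx, hy, hxy, hxx, hyy⟩ :=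
    exists_principal_frame hr0.smooth hr0.inj hr0.norm hr0.orth hpd
  obtain ⟨u, ξ, h⟩ := exists_isLocalGraph hY hr0.inj e
    (fun w => by rw [he2, inner_neg_right, hr0.orth, neg_zero])
  refine ⟨e, u, ξ, -inner ℝ (fderiv ℝ (fderiv ℝ (localParam (Y t₀) p₀)) (coordAt p₀) x x) (ν t₀ p₀),
    -inner ℝ (fderiv ℝ (fderiv ℝ (localParam (Y t₀) p₀)) (coordAt p₀) y y) (ν t₀ p₀), h, ?_⟩
  set z₀ : ℝ × E2 := (t₀, frameProj e (Y t₀ p₀)) with hz₀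
  have hu2 : ContDiffAt ℝ 2 u z₀ := h.eventually_contDiffAt.self_of_nhds
  have hfac0 := h.eventually_factor.self_of_nhds
  have horthΨ := (hr0.curvature_of_graph hu2 hfac0).1
  have hgrad : ∀ w, dirDeriv (0, w) u z₀ = 0 := by
    intro w
    have := horthΨ w
    rw [fderiv_graphPoint_apply (z := z₀) (hu2.differentiableAt (by simp)), frameLift_apply,
      ← neg_eq_zero, ← inner_neg_right, ← he2] at this
    simp only [inner_add_left, real_inner_smul_left, inner_frame] at this
    simpa using this
  have hhess : ∀ v w : E2, inner ℝ (fderiv ℝ (fderiv ℝ (localParam (Y t₀) p₀)) (coordAt p₀) v w)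
      (ν t₀ p₀) = -dirDeriv (0, frameProj e (fderiv ℝ (localParam (Y t₀) p₀) (coordAt p₀) v))
        (dirDeriv (0, frameProj e (fderiv ℝ (localParam (Y t₀) p₀) (coordAt p₀) w)) u) z₀ := by
    intro v w
    set σ : E2 → E2 := fun v => frameProj e (localParam (Y t₀) p₀ v) with hσ
    have hσ0 : σ (coordAt p₀) = frameProj e (Y t₀ p₀) := by
      rw [hσ]; simp only [localParam_coordAt]
    have hσs : ContDiffAt ℝ 2 σ (coordAt p₀) :=
      (frameProj e).contDiff.contDiffAt.comp _ hr0.smooth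
    have hσd : ∀ w, fderiv ℝ σ (coordAt p₀) w =
        frameProj e (fderiv ℝ (localParam (Y t₀) p₀) (coordAt p₀) w) := fun w => by
      have : HasFDerivAt σ _ (coordAt p₀) := (frameProj e).hasFDerivAt.comp (coordAt p₀)
        (hr0.smooth.differentiableAt (by simp)).hasFDerivAt
      rw [this.fderiv]; rfl
    have hfac : localParam (Y t₀) p₀ =ᶠ[𝓝 (coordAt p₀)] fun v => graphPoint e u (t₀, σ v) :=
      eventually_chart_symm hfac0
    have hg : ContDiffAt ℝ 2 (fun v => graphPoint e u (t₀, v)) (σ (coordAt p₀)) := by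
      rw [hσ0]; exact graphPoint_slice_contDiffAt (z := z₀) hu2
    have h2 := (fderiv_comp_param (Ψ := fun v => graphPoint e u (t₀, v)) hσs hg hfac).2 v w
    rw [h2, hσ0, inner_add_left, horthΨ, fderiv_fderiv_graphPoint_apply (z := z₀) hu2,
      real_inner_smul_left, hσd, hσd, add_zero]
    have : inner ℝ (e 2) (ν t₀ p₀) = (-1 : ℝ) := by
      rw [he2, inner_neg_left, real_inner_self_eq_norm_sq, hr0.norm]; norm_num
    rw [this]; ring
  have hex : frameProj e (e 0) = stdE2 0 := by
    ext i; rw [frameProj_apply, inner_frame]; fin_cases i <;> simp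
  have hey : frameProj e (e 1) = stdE2 1 := by
    ext i; rw [frameProj_apply, inner_frame]; fin_cases i <;> simp
  have hxx' := hhess x x
  have hxy' := hhess x y
  have hyy' := hhess y y
  rw [hx, hex] at hxx'
  rw [hx, hy, hex, hey, hxy] at hxy'
  rw [hy, hey] at hyy'
  have ht0 : 0 < dirDeriv (1, 0) u z₀ := by
    have := h.eventually_velocity.self_of_nhds _ hev.self_of_nhds
    rw [this]
    change 0 < _ - dirDeriv (spaceDir 0) u z₀ * _ - dirDeriv (spaceDir 1) u z₀ * _
    rw [hgrad, hgrad, real_inner_smul_right, he2, inner_neg_left, real_inner_self_eq_norm_sq,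
      hr0.norm]
    have := Real.rpow_pos_of_pos hpos.self_of_nhds β
    simpa using this
  -- the evolution equation fixes `∂ₜu` up to sign; by continuity the sign is that at the base point
  have htpos : ∀ᶠ z in 𝓝 z₀, 0 < dirDeriv (1, 0) u z :=
    (h.smooth.dirDeriv _).continuousAt.eventually (lt_mem_nhds ht0)
  have hevol : ∀ᶠ q : ℝ × S2 in 𝓝 (t₀, p₀),
      dirDeriv (1, 0) u (q.1, frameProj e (Y q.1 q.2)) =
      gaussOfGraph (spaceDir 0) (spaceDir 1) u (q.1, frameProj e (Y q.1 q.2)) ^ β *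
        graphArea (dirDeriv (spaceDir 0) u (q.1, frameProj e (Y q.1 q.2)))
          (dirDeriv (spaceDir 1) u (q.1, frameProj e (Y q.1 q.2))) ^ (1 / 2 : ℝ) := by
    filter_upwards [h.eventually_velocity, h.eventually_curvature, hreg, hpos, hev,
      h.tendsto_proj.eventually htpos, h.tendsto_proj.eventually h.eventually_contDiffAt]
      with q q1 q2 q3 q4 q5 q6 q7
    obtain ⟨c1, c2, -⟩ := q2 _ q3
    have q1' := q1 _ q5
    rw [c2] at q1' q4
    have hF := Real.rpow_pos_of_pos q4 β
    set z : ℝ × E2 := (q.1, frameProj e (Y q.1 q.2)) with hz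
    obtain ⟨n0, n1, n2⟩ := graph_normal_coords (z := z) (q7.differentiableAt (by simp)) q3.norm c1
    set F := gaussOfGraph (spaceDir 0) (spaceDir 1) u z ^ β
    have hw := graphArea_pos (dirDeriv (spaceDir 0) u z) (dirDeriv (spaceDir 1) u z)
    simp only [real_inner_smul_right] at q1'
    rw [n0, n1] at q1'
    rw [← Real.sqrt_eq_rpow]
    have hsq := Real.sq_sqrt hw.le
    have hs := Real.sqrt_nonneg (graphArea (dirDeriv (spaceDir 0) u z) (dirDeriv (spaceDir 1) u z))
    have hW : dirDeriv (1, 0) u z = -(F * inner ℝ (e 2) (ν q.1 q.2) *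
        graphArea (dirDeriv (spaceDir 0) u z) (dirDeriv (spaceDir 1) u z)) := by
      rw [q1']; unfold graphArea; ring
    refine (pow_left_inj₀ q6.le (by positivity) two_ne_zero).1 ?_
    rw [mul_pow, hsq, hW]
    linear_combination (F ^ 2 *
      graphArea (dirDeriv (spaceDir 0) u z) (dirDeriv (spaceDir 1) u z)) * n2
  exact
    { smooth := h.smooth
      pos_a := by linarith
      pos_b := by linarith
      grad_x := hgrad _
      grad_y := hgrad _
      hess_xx := by linarith
      hess_xy := by linarith
      hess_yy := by linarith
      evolution := by
        filter_upwards [h.tendsto_point.eventually hevol, h.eventually_proj_point] with z z1 z2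
        simp only [z2] at z1
        exact z1 }

end LocalGraphGeometry

/-! ### Continuity of the curvature up to the initial time -/

section SpatialDerivatives

variable {F : Type*} [NormedAddCommGroup F] [NormedSpace ℝ F] {I : Set ℝ} {f : ℝ × E2 → F}

theorem fderiv_slice_eq (hf : ContDiffOn ℝ ∞ f (I ×ˢ univ)) {q : ℝ × E2}
    (hq : q ∈ I ×ˢ (univ : Set E2)) (w : E2) :
    fderiv ℝ (fun v => f (q.1, v)) q.2 w = fderivWithin ℝ f (I ×ˢ univ) q (0, w) := by
  have h1 : HasFDerivWithinAt f (fderivWithin ℝ f (I ×ˢ univ) q) (I ×ˢ univ) q :=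
    ((hf q hq).differentiableWithinAt (by simp)).hasFDerivWithinAt
  have h2 : HasFDerivWithinAt (fun v : E2 => (q.1, v)) (ContinuousLinearMap.inr ℝ ℝ E2) univ q.2 :=
    (hasFDerivAt_prodMk_right q.1 q.2).hasFDerivWithinAt
  have h3 := HasFDerivWithinAt.comp (f := fun v : E2 => (q.1, v)) (g := f) q.2 h1 h2
    (fun v _ => ⟨hq.1, mem_univ _⟩)
  rw [hasFDerivWithinAt_univ] at h3
  have : fderiv ℝ (fun v => f (q.1, v)) q.2 = _ := h3.fderiv
  rw [this]; rfl

/-- Spatial derivatives of a function which is smooth in space and time are smooth in space and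
time, also at an end point of the time interval. -/
theorem contDiffOn_fderiv_slice (hI : UniqueDiffOn ℝ I) (hf : ContDiffOn ℝ ∞ f (I ×ˢ univ))
    (w : E2) :
    ContDiffOn ℝ ∞ (fun q : ℝ × E2 => fderiv ℝ (fun v => f (q.1, v)) q.2 w) (I ×ˢ univ) := by
  have h := (hf.fderivWithin (m := ∞) (hI.prod uniqueDiffOn_univ) le_rfl).clm_apply
    (contDiffOn_const (c := ((0 : ℝ), w)))
  exact h.congr fun q hq => fderiv_slice_eq hf hq w

theorem contDiffOn_fderiv_fderiv_slice (hI : UniqueDiffOn ℝ I) (hf : ContDiffOn ℝ ∞ f (I ×ˢ univ))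
    (w w' : E2) :
    ContDiffOn ℝ ∞ (fun q : ℝ × E2 => fderiv ℝ (fderiv ℝ (fun v => f (q.1, v))) q.2 w w')
      (I ×ˢ univ) := by
  refine (contDiffOn_fderiv_slice hI (contDiffOn_fderiv_slice hI hf w') w).congr fun q hq => ?_
  have hs : ContDiff ℝ ∞ (fun v => f (q.1, v)) := by
    rw [← contDiffOn_univ]
    exact hf.comp (contDiff_const.prodMk contDiff_id).contDiffOn fun v _ => ⟨hq.1, mem_univ _⟩
  have hd : DifferentiableAt ℝ (fderiv ℝ (fun v => f (q.1, v))) q.2 :=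
    ((hs.fderiv_right (m := 1) (by norm_cast)).differentiable (by simp)) q.2
  rw [fderiv_clm_apply hd (differentiableAt_const w')]
  simp

end SpatialDerivatives

section CurvatureContinuity

variable {T : ℝ} {X : ℝ → S2 → E3}

/-- The curvature functions may be computed in any chart. -/
theorem IsRegularAt.curvature_chart {X : S2 → E3} {p : S2} {n : E3}
    (hX : ContMDiff (𝓡 2) 𝓘(ℝ, E3) ∞ X) (hr : IsRegularAt X p n) {p₀ : S2}
    (hp : p ∈ (chartAt E2 p₀).source) :
    paramGauss (localParam X p) (coordAt p) = paramGauss (localParam X p₀) (chartAt E2 p₀ p) ∧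
    paramMeanSq (localParam X p) (coordAt p) = paramMeanSq (localParam X p₀) (chartAt E2 p₀ p) := by
  have hsymm : (chartAt E2 p).symm (coordAt p) = p :=
    (chartAt E2 p).left_inv (mem_chart_source E2 p)
  set σ : E2 → E2 := fun v => chartAt E2 p₀ ((chartAt E2 p).symm v) with hσ
  have hσ0 : σ (coordAt p) = chartAt E2 p₀ p := by simp only [hσ, hsymm]
  have hσs : ContDiffAt ℝ 2 σ (coordAt p) := by
    have h1 : ContMDiffAt (𝓡 2) (𝓡 2) ∞ (chartAt E2 p).symm (coordAt p) :=
      (contMDiffOn_chart_symm (I := 𝓡 2) (n := ∞) (x := p)).contMDiffAt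
        ((chartAt E2 p).open_target.mem_nhds (mem_chart_target E2 p))
    have h2 : ContMDiffAt (𝓡 2) (𝓡 2) ∞ (chartAt E2 p₀) ((chartAt E2 p).symm (coordAt p)) := by
      rw [hsymm]
      exact (contMDiffOn_chart (I := 𝓡 2) (n := ∞) (x := p₀)).contMDiffAt
        ((chartAt E2 p₀).open_source.mem_nhds hp)
    exact (contMDiffAt_iff_contDiffAt.1 (h2.comp _ h1)).of_le (by norm_cast)
  have hfac : localParam X p =ᶠ[𝓝 (coordAt p)] fun v => localParam X p₀ (σ v) := by
    filter_upwards [eventually_chart_symm ((chartAt E2 p₀).open_source.mem_nhds hp)] with v hv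
    simp only [localParam, hσ]
    rw [(chartAt E2 p₀).left_inv hv]
  have h := (param_change hσs (((contDiff_localParam hX p₀).contDiffAt).of_le (by norm_cast)) hfac
    hr.inj hr.norm hr.orth).2.2
  rwa [hσ0] at h

theorem continuousWithinAt_paramCurvature {I : Set ℝ} (hI : UniqueDiffOn ℝ I) {p₀ : S2}
    (hX : ContDiffOn ℝ ∞ (fun q : ℝ × E2 => localParam (X q.1) p₀ q.2) (I ×ˢ univ)) {q : ℝ × E2}
    (hq : q ∈ I ×ˢ (univ : Set E2)) (hinj : Injective (fderiv ℝ (localParam (X q.1) p₀) q.2)) :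
    ContinuousWithinAt (fun q : ℝ × E2 => paramGauss (localParam (X q.1) p₀) q.2) (I ×ˢ univ) q ∧
    ContinuousWithinAt (fun q : ℝ × E2 => paramMeanSq (localParam (X q.1) p₀) q.2)
      (I ×ˢ univ) q := by
  have d1 : ∀ i, ContinuousWithinAt
      (fun q : ℝ × E2 => fderiv ℝ (localParam (X q.1) p₀) q.2 (stdE2 i)) (I ×ˢ univ) q := fun i =>
    (contDiffOn_fderiv_slice hI hX (stdE2 i)).continuousOn q hq
  have d2 : ∀ i j, ContinuousWithinAt
      (fun q : ℝ × E2 => fderiv ℝ (fderiv ℝ (localParam (X q.1) p₀)) q.2 (stdE2 i) (stdE2 j))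
      (I ×ˢ univ) q := fun i j =>
    (contDiffOn_fderiv_fderiv_slice hI hX (stdE2 i) (stdE2 j)).continuousOn q hq
  have hg : ∀ i j, ContinuousWithinAt
      (fun q : ℝ × E2 => paramFirstForm (localParam (X q.1) p₀) q.2 i j) (I ×ˢ univ) q :=
    fun i j => (d1 i).inner (d1 j)
  have hdet : ContinuousWithinAt
      (fun q : ℝ × E2 => (paramFirstForm (localParam (X q.1) p₀) q.2).det) (I ×ˢ univ) q := by
    simp only [Matrix.det_fin_two]
    exact ((hg 0 0).mul (hg 1 1)).sub ((hg 0 1).mul (hg 1 0))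
  have hc : ∀ {f : ℝ × E2 → E3}, ContinuousWithinAt f (I ×ˢ univ) q → ∀ k : Fin 3,
      ContinuousWithinAt (fun q => f q k) (I ×ˢ univ) q := fun hf k =>
    (EuclideanSpace.proj (𝕜 := ℝ) k).continuous.continuousAt.comp_continuousWithinAt hf
  have htri : ∀ i j, ContinuousWithinAt (fun q : ℝ × E2 =>
      tripleProduct (fderiv ℝ (localParam (X q.1) p₀) q.2 (stdE2 0))
        (fderiv ℝ (localParam (X q.1) p₀) q.2 (stdE2 1))
        (fderiv ℝ (fderiv ℝ (localParam (X q.1) p₀)) q.2 (stdE2 i) (stdE2 j))) (I ×ˢ univ) q := by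
    intro i j
    have a := hc (d1 0)
    have b := hc (d1 1)
    have c := hc (d2 i j)
    unfold tripleProduct
    exact (((a 0).mul (((b 1).mul (c 2)).sub ((b 2).mul (c 1)))).sub
      ((a 1).mul (((b 0).mul (c 2)).sub ((b 2).mul (c 0))))).add
      ((a 2).mul (((b 0).mul (c 1)).sub ((b 1).mul (c 0))))
  have hpos := (paramFirstForm_det_pos hinj).ne'
  exact ⟨(((htri 0 0).mul (htri 1 1)).sub ((htri 0 1).mul (htri 1 0))).div (hdet.pow 2)
      (pow_ne_zero 2 hpos),
    ((((((hg 1 1).mul (htri 0 0)).sub ((hg 0 1).mul (htri 1 0))).sub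
      ((hg 1 0).mul (htri 0 1))).add ((hg 0 0).mul (htri 1 1))).pow 2).div (hdet.pow 3)
      (pow_ne_zero 3 hpos)⟩

end CurvatureContinuity

/-! ### Preservation of convexity -/

section Flow

/-- The Gauss curvature at time `t` of a moving surface, as a function of time and position. -/
noncomputable def flowGauss (X : ℝ → S2 → E3) (q : ℝ × S2) : ℝ :=
  paramGauss (localParam (X q.1) q.2) (coordAt q.2)

/-- The squared mean curvature of a moving surface, as a function of time and position. -/
noncomputable def flowMeanSq (X : ℝ → S2 → E3) (q : ℝ × S2) : ℝ :=
  paramMeanSq (localParam (X q.1) q.2) (coordAt q.2)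

/-- The pinching quantity `K ^ γ (H² - 4K)` of a moving surface. -/
noncomputable def flowPinching (γ : ℝ) (X : ℝ → S2 → E3) (q : ℝ × S2) : ℝ :=
  flowGauss X q ^ γ * (flowMeanSq X q - 4 * flowGauss X q)

theorem IsLocalGraph.eventually_flow_eq {Y : ℝ → S2 → E3} {ν : ℝ → S2 → E3} {t₀ : ℝ} {p₀ : S2}
    {e : OrthonormalBasis (Fin 3) ℝ E3} {u : ℝ × E2 → ℝ} {ξ : ℝ × E2 → S2}
    (h : IsLocalGraph Y t₀ p₀ e u ξ)
    (hreg : ∀ᶠ q : ℝ × S2 in 𝓝 (t₀, p₀), IsRegularAt (Y q.1) q.2 (ν q.1 q.2)) :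
    ∀ᶠ z in 𝓝 (t₀, frameProj e (Y t₀ p₀)),
      gaussOfGraph (spaceDir 0) (spaceDir 1) u z = flowGauss Y (z.1, ξ z) ∧
      ∀ γ, pinchingOfGraph γ (spaceDir 0) (spaceDir 1) u z = flowPinching γ Y (z.1, ξ z) := by
  filter_upwards [h.tendsto_point.eventually (h.eventually_curvature.and hreg),
    h.eventually_proj_point] with z ⟨h1, h2⟩ h3
  obtain ⟨-, hK, hM⟩ := h1 _ h2
  rw [h3] at hK hM
  refine ⟨hK.symm, fun γ => ?_⟩
  unfold flowPinching flowGauss flowMeanSq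
  rw [hK, hM]
  rfl

variable {α T : ℝ} {X ν : ℝ → S2 → E3}

namespace IsGaussCurvatureFlow

theorem regular (h : IsGaussCurvatureFlow α T X ν) {t : ℝ} (ht : t ∈ Ico 0 T) (p : S2) :
    IsRegularAt (X t) p (ν t p) :=
  (h.embedding t ht).isRegularAt (h.normal t ht p)

theorem gaussCurvature_eq (h : IsGaussCurvatureFlow α T X ν) {t : ℝ} (ht : t ∈ Ico 0 T) (p : S2) :
    gaussCurvature (X t) p (ν t p) = flowGauss X (t, p) :=
  (paramGauss_eq (h.regular ht p).inj (h.regular ht p).norm (h.regular ht p).orth).symm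

theorem continuousOn_curvature (h : IsGaussCurvatureFlow α T X ν) :
    ContinuousOn (flowGauss X) (Ico 0 T ×ˢ univ) ∧
      ContinuousOn (flowMeanSq X) (Ico 0 T ×ˢ univ) := by
  have key : ∀ q ∈ Ico 0 T ×ˢ (univ : Set S2),
      ContinuousWithinAt (flowGauss X) (Ico 0 T ×ˢ univ) q ∧
      ContinuousWithinAt (flowMeanSq X) (Ico 0 T ×ˢ univ) q := by
    rintro ⟨t₀, p₀⟩ hq
    have hr := h.regular hq.1 p₀
    obtain ⟨c1, c2⟩ := continuousWithinAt_paramCurvature (X := X) (p₀ := p₀)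
      (uniqueDiffOn_Ico 0 T) (contDiffOn_localParam h.smooth p₀) (q := (t₀, coordAt p₀))
      ⟨hq.1, mem_univ _⟩ hr.inj
    have hc : ContinuousWithinAt (fun q : ℝ × S2 => (q.1, chartAt E2 p₀ q.2)) (Ico 0 T ×ˢ univ)
        (t₀, p₀) :=
      (continuousAt_fst.prodMk (ContinuousAt.comp
        ((chartAt E2 p₀).continuousAt (mem_chart_source E2 p₀))
        continuousAt_snd)).continuousWithinAt
    have hm : MapsTo (fun q : ℝ × S2 => (q.1, chartAt E2 p₀ q.2)) (Ico 0 T ×ˢ univ)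
        (Ico 0 T ×ˢ univ) := fun q hq => ⟨hq.1, mem_univ _⟩
    have hsrc : ∀ᶠ q : ℝ × S2 in 𝓝 (t₀, p₀), q.2 ∈ (chartAt E2 p₀).source :=
      continuousAt_snd.eventually (chart_source_mem_nhds E2 p₀)
    have hev : ∀ᶠ q : ℝ × S2 in 𝓝[Ico 0 T ×ˢ univ] (t₀, p₀),
        flowGauss X q = paramGauss (localParam (X q.1) p₀) (chartAt E2 p₀ q.2) ∧
        flowMeanSq X q = paramMeanSq (localParam (X q.1) p₀) (chartAt E2 p₀ q.2) := by
      filter_upwards [hsrc.filter_mono nhdsWithin_le_nhds, self_mem_nhdsWithin] with q q1 q2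
      exact (h.regular q2.1 q.2).curvature_chart (h.embedding _ q2.1).smooth q1
    have d1 := ContinuousWithinAt.comp (x := (t₀, p₀))
      (f := fun q : ℝ × S2 => (q.1, chartAt E2 p₀ q.2)) c1 hc hm
    have d2 := ContinuousWithinAt.comp (x := (t₀, p₀))
      (f := fun q : ℝ × S2 => (q.1, chartAt E2 p₀ q.2)) c2 hc hm
    exact ⟨d1.congr_of_eventuallyEq (hev.mono fun _ h => h.1)
        (hev.self_of_nhdsWithin ⟨hq.1, mem_univ _⟩).1,
      d2.congr_of_eventuallyEq (hev.mono fun _ h => h.2)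
        (hev.self_of_nhdsWithin ⟨hq.1, mem_univ _⟩).2⟩
  exact ⟨fun q hq => (key q hq).1, fun q hq => (key q hq).2⟩

/-- The normal is continuous in time as long as the Gauss curvature is positive, because it is then
determined by the velocity. -/
theorem continuousOn_normal (h : IsGaussCurvatureFlow α T X ν) {p : S2} {J : Set ℝ}
    (hJ : J ⊆ Ico 0 T) (hK : ∀ s ∈ J, 0 < flowGauss X (s, p)) :
    ContinuousOn (fun s => ν s p) J := by
  have hX : ContDiffOn ℝ ∞ (fun s => X s p) (Ico 0 T) := by
    have h1 := (contDiffOn_localParam h.smooth p).comp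
      (contDiff_id.prodMk contDiff_const).contDiffOn
      (fun s (hs : s ∈ Ico 0 T) => (⟨hs, mem_univ (coordAt p)⟩ : (s, coordAt p) ∈ Ico 0 T ×ˢ univ))
    exact h1.congr fun s _ => (localParam_coordAt (X s) p).symm
  have hV : ContinuousOn (fun s => derivWithin (fun s => X s p) (Ico 0 T) s) J :=
    (hX.continuousOn_derivWithin (uniqueDiffOn_Ico 0 T) (by simp)).mono hJ
  have hKc : ContinuousOn (fun s => flowGauss X (s, p)) J :=
    h.continuousOn_curvature.1.comp (continuousOn_id.prodMk continuousOn_const)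
      fun s hs => ⟨hJ hs, mem_univ _⟩
  have hKp : ContinuousOn (fun s => -(flowGauss X (s, p) ^ (α / 2))⁻¹) J :=
    ((hKc.rpow_const fun s hs => Or.inl (hK s hs).ne').inv₀
      fun s hs => (Real.rpow_pos_of_pos (hK s hs) _).ne').neg
  refine (hKp.smul hV).congr fun s hs => ?_
  have hd := (h.evolution s (hJ hs) p).derivWithin (uniqueDiffOn_Ico 0 T s (hJ hs))
  have hne := (Real.rpow_pos_of_pos (hK s hs) (α / 2)).ne'
  change ν s p = -(flowGauss X (s, p) ^ (α / 2))⁻¹ •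
    derivWithin (fun s => X s p) (Ico 0 T) s
  rw [hd, h.gaussCurvature_eq (hJ hs), smul_smul, neg_mul_neg, inv_mul_cancel₀ hne, one_smul]

/-- Convexity persists as long as the Gauss curvature is positive. -/
theorem posDef (h : IsGaussCurvatureFlow α T X ν) {p : S2}
    (h0 : (secondForm (X 0) p (ν 0 p)).PosDef) {t : ℝ} (ht : t ∈ Ico 0 T)
    (hK : ∀ s ∈ Icc 0 t, 0 < flowGauss X (s, p)) :
    (secondForm (X t) p (ν t p)).PosDef := by
  have hJ : Icc 0 t ⊆ Ico 0 T := fun s hs => ⟨hs.1, hs.2.trans_lt ht.2⟩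
  have hν := h.continuousOn_normal hJ hK
  have hφ : ContinuousOn (fun s => fderiv ℝ (fderiv ℝ (localParam (X s) p)) (coordAt p)
      (stdE2 0) (stdE2 0)) (Icc 0 t) :=
    (contDiffOn_fderiv_fderiv_slice (uniqueDiffOn_Ico 0 T) (contDiffOn_localParam h.smooth p)
      (stdE2 0) (stdE2 0)).continuousOn.comp (continuousOn_id.prodMk continuousOn_const)
      fun s hs => ⟨hJ hs, mem_univ (coordAt p)⟩
  have hcont : ContinuousOn (fun s => secondForm (X s) p (ν s p) 0 0) (Icc 0 t) :=
    (hφ.inner hν).neg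
  have hsym : ∀ s ∈ Icc 0 t, secondForm (X s) p (ν s p) 1 0 = secondForm (X s) p (ν s p) 0 1 := by
    intro s hs
    have hS : IsSymmSndFDerivAt ℝ (localParam (X s) p) (coordAt p) :=
      (h.regular (hJ hs) p).smooth.isSymmSndFDerivAt (by simp)
    simp only [secondForm, Matrix.of_apply]
    rw [hS]
  have hdet : ∀ s ∈ Icc 0 t, 0 < (secondForm (X s) p (ν s p)).det := by
    intro s hs
    have h1 := hK s hs
    rw [← h.gaussCurvature_eq (hJ hs)] at h1
    exact (div_pos_iff_of_pos_right (paramFirstForm_det_pos (h.regular (hJ hs) p).inj)).1 h1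
  have ht' : t ∈ Icc 0 t := ⟨ht.1, le_rfl⟩
  have hpos : 0 < secondForm (X t) p (ν t p) 0 0 := by
    by_contra hneg
    rw [not_lt] at hneg
    obtain ⟨s, hs, hs0⟩ := intermediate_value_Icc' ht.1 hcont ⟨hneg, h0.diag_pos.le⟩
    have hd := hdet s hs
    simp only at hs0
    rw [Matrix.det_fin_two, hs0, hsym s hs] at hd
    nlinarith [mul_self_nonneg (secondForm (X s) p (ν s p) 0 1)]
  have hd := hdet t ht'
  have hs := hsym t ht'
  rw [Matrix.det_fin_two, hs] at hd
  refine Matrix.PosDef.of_dotProduct_mulVec_pos ?_ ?_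
  · ext i j
    fin_cases i <;> fin_cases j <;> simp [hs]
  · intro x hx
    simp only [dotProduct, Matrix.mulVec, Fin.sum_univ_two, Pi.star_apply, star_trivial, hs]
    generalize secondForm (X t) p (ν t p) 0 0 = A at *
    generalize secondForm (X t) p (ν t p) 0 1 = B at *
    generalize secondForm (X t) p (ν t p) 1 1 = C at *
    refine (mul_pos_iff_of_pos_left hpos).1 ?_
    have e : A * (x 0 * (A * x 0 + B * x 1) + x 1 * (B * x 0 + C * x 1)) =
        (A * x 0 + B * x 1) ^ 2 + (A * C - B * B) * x 1 ^ 2 := by ring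
    rw [e]
    by_cases h1 : x 1 = 0
    · have h2 : x 0 ≠ 0 := fun h2 => hx (by ext i; fin_cases i <;> simp [h1, h2])
      rw [h1]
      have : A * x 0 ≠ 0 := mul_ne_zero hpos.ne' h2
      have := sq_pos_of_ne_zero this
      simpa using this
    · have := mul_pos hd (sq_pos_of_ne_zero h1)
      have := sq_nonneg (A * x 0 + B * x 1)
      linarith

/-- Near an interior time and a point where the surface is locally convex, the flow is a graphical
flow whose curvature functions are those of the moving surface. -/
theorem exists_graph (h : IsGaussCurvatureFlow α T X ν) {t₀ : ℝ} (ht₀ : t₀ ∈ Ioo 0 T) {p₀ : S2}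
    (hK : 0 < flowGauss X (t₀, p₀)) (hpd : (secondForm (X t₀) p₀ (ν t₀ p₀)).PosDef) :
    ∃ (z₀ : ℝ × E2) (u : ℝ × E2 → ℝ) (ξ : ℝ × E2 → S2) (a b : ℝ), z₀.1 = t₀ ∧ ξ z₀ = p₀ ∧
      IsConvexGraphFlowAt (α / 2) (spaceDir 0) (spaceDir 1) (1, 0) z₀ u a b ∧
      ∀ᶠ z in 𝓝 z₀, z.1 ∈ Ioo 0 T ∧
        gaussOfGraph (spaceDir 0) (spaceDir 1) u z = flowGauss X (z.1, ξ z) ∧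
        ∀ γ, pinchingOfGraph γ (spaceDir 0) (spaceDir 1) u z = flowPinching γ X (z.1, ξ z) := by
  have hIoo : ∀ᶠ t in 𝓝 t₀, t ∈ Ioo 0 T := Ioo_mem_nhds ht₀.1 ht₀.2
  have hIoo' : ∀ᶠ q : ℝ × S2 in 𝓝 (t₀, p₀), q.1 ∈ Ioo 0 T := continuousAt_fst.eventually hIoo
  have hI : Ioo (0 : ℝ) T ⊆ Ico 0 T := Ioo_subset_Ico_self
  have hY : ContDiffAt ℝ ∞ (fun q : ℝ × E2 => localParam (X q.1) p₀ q.2) (t₀, coordAt p₀) :=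
    (contDiffOn_localParam h.smooth p₀).contDiffAt
      (prod_mem_nhds (mem_of_superset (Ioo_mem_nhds ht₀.1 ht₀.2) hI) univ_mem)
  have hreg : ∀ᶠ q : ℝ × S2 in 𝓝 (t₀, p₀), IsRegularAt (X q.1) q.2 (ν q.1 q.2) := by
    filter_upwards [hIoo'] with q hq
    exact h.regular (hI hq) q.2
  have hcK : ContinuousAt (flowGauss X) (t₀, p₀) :=
    h.continuousOn_curvature.1.continuousAt
      (prod_mem_nhds (mem_of_superset (Ioo_mem_nhds ht₀.1 ht₀.2) hI) univ_mem)
  have hpos : ∀ᶠ q : ℝ × S2 in 𝓝 (t₀, p₀), 0 < flowGauss X q := hcK.eventually (lt_mem_nhds hK)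
  have hev : ∀ᶠ q : ℝ × S2 in 𝓝 (t₀, p₀), HasDerivAt (fun s => X s q.2)
      (-(flowGauss X q ^ (α / 2)) • ν q.1 q.2) q.1 := by
    filter_upwards [hIoo'] with q hq
    have h1 := h.evolution q.1 (hI hq) q.2
    rw [h.gaussCurvature_eq (hI hq)] at h1
    exact h1.hasDerivAt (mem_of_superset (Ioo_mem_nhds hq.1 hq.2) hI)
  obtain ⟨e, u, ξ, a, b, hg, hf⟩ := exists_convexGraphFlow hY hreg hpos hev hpd
  refine ⟨_, u, ξ, a, b, rfl, hg.base, hf, ?_⟩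
  filter_upwards [hg.eventually_flow_eq hreg, continuousAt_fst.eventually hIoo] with z h1 h2
  exact ⟨h2, h1⟩

/-- The Gauss curvature stays above its initial minimum as long as it is positive. -/
theorem gauss_lower_of_pos (h : IsGaussCurvatureFlow α T X ν) (hα : 0 < α)
    (h0 : IsStrictlyConvex (X 0) (ν 0)) {m t₁ : ℝ} (ht₁ : t₁ ∈ Ico 0 T)
    (hm : ∀ p, m ≤ flowGauss X (0, p))
    (hK : ∀ q ∈ Icc 0 t₁ ×ˢ (univ : Set S2), 0 < flowGauss X q) :
    ∀ q ∈ Icc 0 t₁ ×ˢ (univ : Set S2), m ≤ flowGauss X q := by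
  have hsub : Icc 0 t₁ ×ˢ (univ : Set S2) ⊆ Ico 0 T ×ˢ univ := fun q hq =>
    ⟨⟨hq.1.1, hq.1.2.trans_lt ht₁.2⟩, mem_univ _⟩
  obtain ⟨⟨t₀, p₀⟩, hq₀, hmin⟩ := (isCompact_Icc.prod isCompact_univ).exists_isMinOn
    (s := Icc 0 t₁ ×ˢ (univ : Set S2))
    ⟨(0, ⟨EuclideanSpace.single 0 1, by simp⟩), ⟨le_rfl, ht₁.1⟩, mem_univ _⟩
    (h.continuousOn_curvature.1.mono hsub)
  intro q hq
  refine le_trans ?_ (hmin hq)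
  rcases hq₀.1.1.eq_or_lt with ht0 | ht0
  · simp only at ht0
    rw [← ht0]; exact hm p₀
  exfalso
  have hpd : (secondForm (X t₀) p₀ (ν t₀ p₀)).PosDef := h.posDef (h0 p₀) (hsub hq₀).1
    fun s hs => hK _ ⟨⟨hs.1, hs.2.trans hq₀.1.2⟩, mem_univ _⟩
  obtain ⟨z₀, u, ξ, a, b, hz, hξ, hf, hev⟩ :=
    h.exists_graph ⟨ht0, (hsub hq₀).1.2⟩ (hK _ hq₀) hpd
  have hmin' : ∀ᶠ z in 𝓝 z₀, z.1 ≤ t₀ → gaussOfGraph (spaceDir 0) (spaceDir 1) u z₀ ≤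
      gaussOfGraph (spaceDir 0) (spaceDir 1) u z := by
    filter_upwards [hev] with z h1 h2
    rw [hev.self_of_nhds.2.1, h1.2.1, hz, hξ]
    exact hmin ⟨⟨h1.1.1.le, h2.trans hq₀.1.2⟩, mem_univ _⟩
  have htend : ∀ v : ℝ × E2, Tendsto (fun s : ℝ => z₀ + s • v) (𝓝 0) (𝓝 z₀) := fun v => by
    have : Continuous fun s : ℝ => z₀ + s • v := by fun_prop
    simpa using this.tendsto 0
  have hspace : ∀ i, IsLocalMin
      (fun s : ℝ => gaussOfGraph (spaceDir 0) (spaceDir 1) u (z₀ + s • spaceDir i)) 0 := fun i => by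
    filter_upwards [(htend (spaceDir i)).eventually hmin'] with s hs
    simpa using hs (by simp [hz])
  obtain ⟨k₁, k₂, hj, hk⟩ := hf.gauss_deriv_pos (by linarith) (hspace 0) (hspace 1)
  have := (hj.const_mul (-1)).nonneg_of_eventually_le (by
    filter_upwards [((htend (1, 0)).eventually hmin').filter_mono nhdsWithin_le_nhds,
      self_mem_nhdsWithin] with s hs hs0
    have := hs (by simpa [hz] using (le_of_lt hs0 : s ≤ 0))
    linarith)
  linarith

theorem exists_gauss_min (h : IsGaussCurvatureFlow α T X ν) (hT : 0 < T)
    (h0 : IsStrictlyConvex (X 0) (ν 0)) : ∃ m, 0 < m ∧ ∀ p, m ≤ flowGauss X (0, p) := by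
  have h00 : (0 : ℝ) ∈ Ico 0 T := ⟨le_rfl, hT⟩
  have hc : ContinuousOn (fun p => flowGauss X (0, p)) univ :=
    h.continuousOn_curvature.1.comp (continuousOn_const.prodMk continuousOn_id)
      fun p _ => ⟨h00, mem_univ _⟩
  obtain ⟨p, -, hp⟩ := isCompact_univ.exists_isMinOn (s := (univ : Set S2))
    ⟨⟨EuclideanSpace.single 0 1, by simp⟩, mem_univ _⟩ hc
  refine ⟨_, ?_, fun p' => hp (mem_univ p')⟩
  simp only
  rw [← h.gaussCurvature_eq h00]
  exact div_pos (h0 p).det_pos (paramFirstForm_det_pos (h.regular h00 p).inj)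

/-- The Gauss curvature stays above its initial minimum. -/
theorem gauss_lower (h : IsGaussCurvatureFlow α T X ν) (hα : 0 < α)
    (h0 : IsStrictlyConvex (X 0) (ν 0)) {m : ℝ} (hm0 : 0 < m)
    (hm : ∀ p, m ≤ flowGauss X (0, p)) :
    ∀ q ∈ Ico 0 T ×ˢ (univ : Set S2), m ≤ flowGauss X q := by
  suffices H : ∀ t₁ ∈ Ico 0 T, ∀ q ∈ Icc 0 t₁ ×ˢ (univ : Set S2), 0 < flowGauss X q by
    intro q hq
    exact h.gauss_lower_of_pos hα h0 hq.1 hm (H q.1 hq.1) q ⟨⟨hq.1.1, le_rfl⟩, mem_univ _⟩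
  intro t₁ ht₁
  have hsub : Icc 0 t₁ ×ˢ (univ : Set S2) ⊆ Ico 0 T ×ˢ univ := fun q hq =>
    ⟨⟨hq.1.1, hq.1.2.trans_lt ht₁.2⟩, mem_univ _⟩
  have hc := h.continuousOn_curvature.1.mono hsub
  -- otherwise consider the first time at which the curvature drops to `m / 2`
  by_contra! hneg
  obtain ⟨q₁, hq₁, hneg⟩ := hneg
  have hcomp : IsCompact (Icc 0 t₁ ×ˢ (univ : Set S2) ∩ flowGauss X ⁻¹' Iic (m / 2)) :=
    (isCompact_Icc.prod isCompact_univ).of_isClosed_subset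
      (hc.preimage_isClosed_of_isClosed (isClosed_Icc.prod isClosed_univ) isClosed_Iic)
      inter_subset_left
  obtain ⟨⟨t₀, p₀⟩, ⟨hq₀, hle⟩, hfirst⟩ := hcomp.exists_isMinOn
    ⟨q₁, hq₁, show flowGauss X q₁ ≤ m / 2 by linarith⟩ continuous_fst.continuousOn
  have hle' : flowGauss X (t₀, p₀) ≤ m / 2 := hle
  have hbefore : ∀ t ∈ Ico 0 t₀, ∀ p, m / 2 < flowGauss X (t, p) := by
    intro t ht p
    by_contra! hcon
    have : t₀ ≤ t := hfirst (a := (t, p))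
      ⟨⟨⟨ht.1, ht.2.le.trans hq₀.1.2⟩, mem_univ _⟩, hcon⟩
    exact absurd ht.2 (not_lt.2 this)
  have ht0 : 0 < t₀ := by
    rcases hq₀.1.1.eq_or_lt with ht0 | ht0
    · simp only at ht0
      rw [← ht0] at hle'
      have := hm p₀
      linarith
    · exact ht0
  have hpos : ∀ q ∈ Icc 0 t₀ ×ˢ (univ : Set S2), 0 < flowGauss X q := by
    rintro ⟨t, p⟩ hq
    rcases hq.1.2.lt_or_eq with ht | ht
    · have := hbefore t ⟨hq.1.1, ht⟩ p
      linarith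
    · simp only at ht
      subst ht
      have hct : ContinuousWithinAt (fun s => flowGauss X (s, p)) (Ico 0 t) t :=
        ContinuousWithinAt.comp (f := fun s => (s, p)) (hc (t, p) ⟨hq₀.1, mem_univ _⟩)
          (continuous_id.prodMk continuous_const).continuousWithinAt
          fun s hs => ⟨⟨hs.1, hs.2.le.trans hq₀.1.2⟩, mem_univ _⟩
      have hne : (𝓝[Ico 0 t] t).NeBot := by
        rw [← mem_closure_iff_nhdsWithin_neBot, closure_Ico ht0.ne]
        exact ⟨ht0.le, le_rfl⟩
      have := ge_of_tendsto hct (by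
        filter_upwards [self_mem_nhdsWithin] with s hs
        exact (hbefore s hs p).le)
      linarith
  have := h.gauss_lower_of_pos hα h0 (hsub hq₀).1 hm hpos (t₀, p₀) ⟨⟨ht0.le, le_rfl⟩, mem_univ _⟩
  linarith

end IsGaussCurvatureFlow

end Flow

/-! ### The pinching estimate -/

section PinchingEstimate

theorem IsConvexGraphFlowAt.pinching_val {V : Type*} [NormedAddCommGroup V] [NormedSpace ℝ V]
    {β : ℝ} {ex ey et z : V} {u : V → ℝ} {a b : ℝ} (h : IsConvexGraphFlowAt β ex ey et z u a b)
    (γ : ℝ) : pinchingOfGraph γ ex ey u z = (a * b) ^ γ * (a - b) ^ 2 := by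
  unfold pinchingOfGraph graphPinching graphMeanSq graphGauss graphArea
  rw [h.grad_x, h.grad_y, h.hess_xx, h.hess_xy, h.hess_yy]
  simp only [ne_eq, OfNat.ofNat_ne_zero, not_false_eq_true, zero_pow, sub_zero, add_zero,
    Real.one_rpow, mul_one, one_mul, mul_zero]
  ring

variable {α T : ℝ} {X ν : ℝ → S2 → E3}

namespace IsGaussCurvatureFlow

theorem continuousOn_pinching (h : IsGaussCurvatureFlow α T X ν)
    (hK : ∀ q ∈ Ico 0 T ×ˢ (univ : Set S2), 0 < flowGauss X q) (γ : ℝ) :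
    ContinuousOn (flowPinching γ X) (Ico 0 T ×ˢ univ) :=
  (h.continuousOn_curvature.1.rpow_const fun q hq => Or.inl (hK q hq).ne').mul
    (h.continuousOn_curvature.2.sub (continuousOn_const.mul h.continuousOn_curvature.1))

/-- The maximum of the pinching quantity `K ^ (α - 2) (H² - 4K)` does not increase. -/
theorem pinching_upper (h : IsGaussCurvatureFlow α T X ν) (hα : α ∈ Icc (1 : ℝ) 2)
    (h0 : IsStrictlyConvex (X 0) (ν 0))
    (hK : ∀ q ∈ Ico 0 T ×ˢ (univ : Set S2), 0 < flowGauss X q) {g : ℝ} (hg0 : 0 ≤ g)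
    (hg : ∀ p, flowPinching (α - 2) X (0, p) ≤ g) :
    ∀ q ∈ Ico 0 T ×ˢ (univ : Set S2), flowPinching (α - 2) X q ≤ g := by
  -- it suffices to bound the quantity by `g + ε t` for all `ε > 0`
  suffices H : ∀ t₁ ∈ Ico 0 T, ∀ ε > 0, ∀ q ∈ Icc 0 t₁ ×ˢ (univ : Set S2),
      flowPinching (α - 2) X q - ε * q.1 ≤ g by
    intro q hq
    refine le_of_forall_pos_le_add fun δ hδ => ?_
    have hq1 : 0 ≤ q.1 := hq.1.1
    have h1 := H q.1 hq.1 (δ / (q.1 + 1)) (by positivity) q ⟨⟨hq1, le_rfl⟩, mem_univ _⟩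
    have h2 : δ / (q.1 + 1) * q.1 ≤ δ := by
      rw [div_mul_eq_mul_div, div_le_iff₀ (by positivity)]
      nlinarith
    linarith
  intro t₁ ht₁ ε hε
  have hsub : Icc 0 t₁ ×ˢ (univ : Set S2) ⊆ Ico 0 T ×ˢ univ := fun q hq =>
    ⟨⟨hq.1.1, hq.1.2.trans_lt ht₁.2⟩, mem_univ _⟩
  obtain ⟨⟨t₀, p₀⟩, hq₀, hmax⟩ := (isCompact_Icc.prod isCompact_univ).exists_isMaxOn
    (s := Icc 0 t₁ ×ˢ (univ : Set S2)) (f := fun q => flowPinching (α - 2) X q - ε * q.1)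
    ⟨(0, ⟨EuclideanSpace.single 0 1, by simp⟩), ⟨le_rfl, ht₁.1⟩, mem_univ _⟩
    (((h.continuousOn_pinching hK _).mono hsub).sub
      (continuousOn_const.mul continuous_fst.continuousOn))
  intro q hq
  refine (hmax hq).trans ?_
  simp only
  rcases hq₀.1.1.eq_or_lt with ht0 | ht0
  · simp only at ht0
    rw [← ht0]
    simpa using hg p₀
  have ht0' : 0 < t₀ := ht0
  have hpd : (secondForm (X t₀) p₀ (ν t₀ p₀)).PosDef := h.posDef (h0 p₀) (hsub hq₀).1
    fun s hs => hK _ ⟨⟨hs.1, hs.2.trans_lt (hsub hq₀).1.2⟩, mem_univ _⟩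
  obtain ⟨z₀, u, ξ, a, b, hz, hξ, hf, hev⟩ :=
    h.exists_graph ⟨ht0, (hsub hq₀).1.2⟩ (hK _ (hsub hq₀)) hpd
  have hbase : pinchingOfGraph (α - 2) (spaceDir 0) (spaceDir 1) u z₀ =
      flowPinching (α - 2) X (t₀, p₀) := by rw [hev.self_of_nhds.2.2, hz, hξ]
  -- at an umbilic point the quantity vanishes, so that the maximum is at most `0`
  by_cases hab : a = b
  · rw [← hbase, hf.pinching_val, hab, sub_self]
    have := mul_pos hε ht0'
    linarith
  exfalso
  have hmax' : ∀ᶠ z in 𝓝 z₀, z.1 ≤ t₀ →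
      pinchingOfGraph (α - 2) (spaceDir 0) (spaceDir 1) u z + -ε * z.1 ≤
      pinchingOfGraph (α - 2) (spaceDir 0) (spaceDir 1) u z₀ + -ε * z₀.1 := by
    filter_upwards [hev] with z h1 h2
    rw [hbase, h1.2.2, hz]
    have : flowPinching (α - 2) X (z.1, ξ z) - ε * z.1 ≤
        flowPinching (α - 2) X (t₀, p₀) - ε * t₀ :=
      hmax (a := (z.1, ξ z)) ⟨⟨h1.1.1.le, h2.trans hq₀.1.2⟩, mem_univ _⟩
    linarith
  have htend : ∀ v : ℝ × E2, Tendsto (fun s : ℝ => z₀ + s • v) (𝓝 0) (𝓝 z₀) := fun v => by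
    have : Continuous fun s : ℝ => z₀ + s • v := by fun_prop
    simpa using this.tendsto 0
  have hspace : ∀ i, IsLocalMax (fun s : ℝ =>
      pinchingOfGraph (α - 2) (spaceDir 0) (spaceDir 1) u (z₀ + s • spaceDir i)) 0 := fun i => by
    filter_upwards [(htend (spaceDir i)).eventually hmax'] with s hs
    simpa using hs (by simp [hz])
  have hγ : 2 * (α / 2) - 2 = α - 2 := by ring
  obtain ⟨g₀, g₁, g₂, hj, hk⟩ := hf.pinching_deriv_nonpos (by linarith [hα.1]) (by linarith [hα.2])
    hab (by rw [hγ]; exact hspace 0) (by rw [hγ]; exact hspace 1)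
  rw [hγ] at hj
  have htime : HasJet ((1 : ℝ), (0 : E2)) z₀ (fun z : ℝ × E2 => z.1) z₀.1 1 _ :=
    ⟨contDiffAt_fst, rfl, by simp [dirDeriv, fderiv_fst], rfl⟩
  have := (hj.add (htime.const_mul (-ε))).nonneg_of_eventually_le (by
    filter_upwards [((htend (1, 0)).eventually hmax').filter_mono nhdsWithin_le_nhds,
      self_mem_nhdsWithin] with s hs hs0
    exact hs (by simpa [hz] using (le_of_lt hs0 : s ≤ 0)))
  linarith

theorem exists_pinching_max (h : IsGaussCurvatureFlow α T X ν) (hT : 0 < T)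
    (hK : ∀ q ∈ Ico 0 T ×ˢ (univ : Set S2), 0 < flowGauss X q) (γ : ℝ) :
    ∃ g, 0 ≤ g ∧ ∀ p, flowPinching γ X (0, p) ≤ g := by
  have hc : ContinuousOn (fun p => flowPinching γ X (0, p)) univ :=
    (h.continuousOn_pinching hK γ).comp (continuousOn_const.prodMk continuousOn_id)
      fun p _ => ⟨⟨le_rfl, hT⟩, mem_univ _⟩
  obtain ⟨p, -, hp⟩ := isCompact_univ.exists_isMaxOn (s := (univ : Set S2))
    ⟨⟨EuclideanSpace.single 0 1, by simp⟩, mem_univ _⟩ hc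
  exact ⟨max 0 (flowPinching γ X (0, p)), le_max_left _ _,
    fun p' => (hp (mem_univ p')).trans (le_max_right _ _)⟩

/-- The principal radii are pinched in terms of lower and upper bounds for the Gauss curvature and
the pinching quantity. -/
theorem radii_ratio_le (h : IsGaussCurvatureFlow α T X ν) (hα : 1 ≤ α) {m g t : ℝ} (hm0 : 0 < m)
    (hg0 : 0 ≤ g) (ht : t ∈ Ico 0 T) (p : S2) (hm : m ≤ flowGauss X (t, p))
    (hg : flowPinching (α - 2) X (t, p) ≤ g) {r₁ r₂ : ℝ}
    (hr : ArePrincipalRadii (X t) p (ν t p) r₁ r₂) :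
    1 / (2 + g * m ^ (1 - α)) ≤ r₂ / r₁ ∧ r₂ / r₁ ≤ 2 + g * m ^ (1 - α) := by
  have hreg := h.regular ht p
  have hK : 0 < flowGauss X (t, p) := hm0.trans_le hm
  obtain ⟨hsum, hprod⟩ := principalRadii_sum_sq_and_mul hreg.inj hreg.norm hreg.orth hK hr
  change _ = flowMeanSq X (t, p) / flowGauss X (t, p) ^ 2 at hsum
  change _ = 1 / flowGauss X (t, p) at hprod
  unfold flowPinching at hg
  generalize flowGauss X (t, p) = K at *
  generalize flowMeanSq X (t, p) = M at *
  have hmul : 0 < r₁ * r₂ := by rw [hprod]; positivity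
  have h1 : r₁ ≠ 0 := fun h => by simp [h] at hmul
  have h2 : r₂ ≠ 0 := fun h => by simp [h] at hmul
  have hratio : 0 < r₂ / r₁ := by
    have : r₂ / r₁ = r₁ * r₂ / r₁ ^ 2 := by field_simp
    rw [this]; positivity
  have hinv : 0 < r₁ / r₂ := by
    rw [← inv_div]; exact inv_pos.2 hratio
  -- `r₁ / r₂ + r₂ / r₁ = H² / K - 2`, and `(H² - 4K) / K` is the pinching quantity times
  -- `K ^ (1 - α)`
  have hsum' : r₂ / r₁ + r₁ / r₂ = 2 + (M - 4 * K) / K := by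
    have e1 : r₂ / r₁ + r₁ / r₂ = (r₁ + r₂) ^ 2 / (r₁ * r₂) - 2 := by field_simp; ring
    rw [e1, hsum, hprod]
    field_simp
    ring
  have hbound : (M - 4 * K) / K ≤ g * m ^ (1 - α) := by
    have e2 : (M - 4 * K) / K = K ^ (α - 2) * (M - 4 * K) * K ^ (1 - α) := by
      have : K ^ (α - 2) * K ^ (1 - α) = K⁻¹ := by
        rw [← Real.rpow_add hK, ← Real.rpow_neg_one]; congr 1; ring
      rw [mul_right_comm, this]; ring
    rw [e2]
    have e3 : K ^ (1 - α) ≤ m ^ (1 - α) := Real.rpow_le_rpow_of_nonpos hm0 hm (by linarith)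
    exact mul_le_mul hg e3 (Real.rpow_nonneg hK.le _) hg0
  have hle : r₂ / r₁ ≤ 2 + g * m ^ (1 - α) := by linarith
  have hle' : r₁ / r₂ ≤ 2 + g * m ^ (1 - α) := by linarith
  refine ⟨?_, hle⟩
  rw [one_div, ← inv_div r₁ r₂]
  exact inv_anti₀ hinv hle'

end IsGaussCurvatureFlow

end PinchingEstimate

section Reparametrization

/-- The curvature functions at a point of a convex surface depend only on the image of the
embedding. -/
theorem curvature_eq_of_range_eq {X X' : S2 → E3} {n n' : E3} {p p' : S2}
    (hX : IsSmoothEmbeddedSphere X) (hX' : IsSmoothEmbeddedSphere X')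
    (hrange : range X' = range X) (hp : X' p' = X p) (hn : IsRegularAt X p n)
    (hn' : IsRegularAt X' p' n') (hpd : (secondForm X p n).PosDef) :
    paramGauss (localParam X' p') (coordAt p') = paramGauss (localParam X p) (coordAt p) ∧
    paramMeanSq (localParam X' p') (coordAt p') = paramMeanSq (localParam X p) (coordAt p) := by
  have hY : ContDiffAt ℝ ∞ (fun q : ℝ × E2 => localParam ((fun _ : ℝ => X) q.1) p q.2)
      (0, coordAt p) := ((contDiff_localParam hX.smooth p).comp contDiff_snd).contDiffAt
  obtain ⟨e, -, -, he2, -⟩ := exists_principal_frame hn.smooth hn.inj hn.norm hn.orth hpd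
  obtain ⟨u, ξ, h⟩ := exists_isLocalGraph (Y := fun _ => X) hY hn.inj e
    (fun w => by rw [he2, inner_neg_right, hn.orth, neg_zero])
  have hu2 : ContDiffAt ℝ 2 u (0, frameProj e (X p)) := h.eventually_contDiffAt.self_of_nhds
  have hfac : ∀ᶠ p₁ in 𝓝 p, X p₁ = graphPoint e u (0, frameProj e (X p₁)) :=
    h.eventually_factor.self_of_nhds
  have hfac' : ∀ᶠ p₁ in 𝓝 p', X' p₁ = graphPoint e u (0, frameProj e (X' p₁)) := by
    have h1 : ∀ᶠ y in 𝓝[range X] (X p), y = graphPoint e u (0, frameProj e y) := by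
      rw [← hX.embedding.map_nhds_eq]
      exact hfac
    have h2 : Tendsto X' (𝓝 p') (𝓝[range X] (X p)) := by
      rw [← hp]
      exact tendsto_nhdsWithin_iff.2 ⟨hX'.embedding.continuous.tendsto p',
        Eventually.of_forall fun p₁ => hrange ▸ mem_range_self p₁⟩
    exact h2.eventually h1
  obtain ⟨-, k1, m1⟩ := hn.curvature_of_graph hu2 hfac
  rw [← hp] at hu2 k1 m1
  obtain ⟨-, k2, m2⟩ := hn'.curvature_of_graph hu2 hfac'
  exact ⟨k2.trans k1.symm, m2.trans m1.symm⟩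

end Reparametrization

/-! ### Proof of the theorem -/

theorem corollary2p5 (α : ℝ) (hα : α ∈ Set.Icc (1 : ℝ) 2) (M₀ : Set E3) :
    ∃ C₁ : ℝ, 0 < C₁ ∧
      ∀ (T : ℝ) (X ν : ℝ → S2 → E3), 0 < T →
        IsGaussCurvatureFlow α T X ν →
        Set.range (X 0) = M₀ →
        IsStrictlyConvex (X 0) (ν 0) →
        ∀ t ∈ Set.Ico 0 T,
          IsStrictlyConvex (X t) (ν t) ∧
          ∀ (p : S2) (r₁ r₂ : ℝ), ArePrincipalRadii (X t) p (ν t p) r₁ r₂ →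
            1 / C₁ ≤ r₂ / r₁ ∧ r₂ / r₁ ≤ C₁ := by
  have hα0 : 0 < α := by linarith [hα.1]
  by_cases hex : ∃ (T : ℝ) (X ν : ℝ → S2 → E3), 0 < T ∧ IsGaussCurvatureFlow α T X ν ∧
      range (X 0) = M₀ ∧ IsStrictlyConvex (X 0) (ν 0)
  · obtain ⟨T, X, ν, hT, h, hM, h0⟩ := hex
    obtain ⟨m, hm0, hm⟩ := h.exists_gauss_min hT h0
    obtain ⟨g, hg0, hg⟩ := h.exists_pinching_max hT
      (fun q hq => hm0.trans_le (h.gauss_lower hα0 h0 hm0 hm q hq)) (α - 2)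
    have hC : 0 < 2 + g * m ^ (1 - α) := by positivity
    refine ⟨_, hC, fun T' X' ν' hT' h' hM' h0' t ht => ?_⟩
    -- the initial bounds for one parametrization of `M₀` hold for any other
    have key : ∀ p', m ≤ flowGauss X' (0, p') ∧ flowPinching (α - 2) X' (0, p') ≤ g := by
      intro p'
      obtain ⟨p, hp⟩ : X' 0 p' ∈ range (X 0) := by rw [hM, ← hM']; exact mem_range_self p'
      have i0 : (0 : ℝ) ∈ Ico 0 T := ⟨le_rfl, hT⟩
      have i0' : (0 : ℝ) ∈ Ico 0 T' := ⟨le_rfl, hT'⟩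
      obtain ⟨e1, e2⟩ := curvature_eq_of_range_eq (h.embedding 0 i0) (h'.embedding 0 i0')
        (hM'.trans hM.symm) hp.symm (h.regular i0 p) (h'.regular i0' p') (h0 p)
      have e1' : flowGauss X' (0, p') = flowGauss X (0, p) := e1
      have e2' : flowMeanSq X' (0, p') = flowMeanSq X (0, p) := e2
      refine ⟨by rw [e1']; exact hm p, ?_⟩
      have := hg p
      unfold flowPinching at this ⊢
      rw [e1', e2']; exact this
    have hlow := h'.gauss_lower hα0 h0' hm0 fun p => (key p).1
    have hpos : ∀ q ∈ Ico 0 T' ×ˢ (univ : Set S2), 0 < flowGauss X' q := fun q hq =>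
      hm0.trans_le (hlow q hq)
    have hup := h'.pinching_upper hα h0' hpos hg0 fun p => (key p).2
    refine ⟨fun p => h'.posDef (h0' p) ht fun s hs =>
      hpos _ ⟨⟨hs.1, hs.2.trans_lt ht.2⟩, mem_univ _⟩, fun p r₁ r₂ hr => ?_⟩
    exact h'.radii_ratio_le hα.1 hm0 hg0 ht p (hlow _ ⟨ht, mem_univ _⟩) (hup _ ⟨ht, mem_univ _⟩) hr
  · exact ⟨1, one_pos, fun T X ν hT h hM h0 => absurd ⟨T, X, ν, hT, h, hM, h0⟩ hex⟩
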